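/- **The swimmer.** Let $L,L_2,\xi,\eta>0$. A planar three-link swimmer has two external arms of length $L$ (links 1 and 3) and a central link of length $L_2$ (link 2). Its state is $z=(\beta_1,\beta_3,x,y,\theta)\in\mathbb R^5$, where $\mathbf x=(x,y)$ is the center of the central link, and links 1, 2, 3 have angles $\varphi_1=\theta-\beta_1$, $\varphi_2=\theta$, $\varphi_3=\theta-\beta_3$ with the $x$-axis. Put $e_i^{\parallel}=(\cos\varphi_i,\sin\varphi_i)$, $e_i^{\perp}=(-\sin\varphi_i,\cos\varphi_i)$. The points of the links are $\mathbf x_1(s)=\mathbf x-\frac{L_2}{2}e_2^{\parallel}-s\,e_1^{\parallel}$ $(0\le s\le L)$, $\mathbf x_2(s)=\mathbf x-(s-\frac{L_2}{2})e_2^{\parallel}$ $(0\le s\le L_2)$, $\mathbf x_3(s)=\mathbf x+\frac{L_2}{2}e_2^{\parallel}+s\,e_3^{\parallel}$ $(0\le s\le L)$, with velocities $\mathbf v_i(s)=\frac{d}{dt}\mathbf x_i(s)$. Resistive force theory prescribes the force density $\mathbf f_i=-\xi(\mathbf v_i\cdot e_i^{\parallel})e_i^{\parallel}-\eta(\mathbf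 v_i\cdot e_i^{\perp})e_i^{\perp}$. The total force and the total torque about $\mathbf x$ (integrals over the three links) are linear in the velocities, so that setting them to zero reads $A(z)(\dot x,\dot y,\dot\theta)^T-B(z)(\dot\beta_1,\dot\beta_3)^T=0$. Let $g_1(z),g_2(z)\in\mathbb R^5$ be the columns of $\begin{pmatrix} I_2\\ A(z)^{-1}B(z)\end{pmatrix}$; the dynamics is $\dot z=\dot\beta_1g_1(z)+\dot\beta_3g_2(z)$. Write $[g_1,g_2]=Dg_2\cdot g_1-Dg_1\cdot g_2$. **The stroke.** For $a=(a_1,\dots,a_4)$ with all $a_i\ge 0$, the *clockwise* octagonal stroke is the closed curve in the $(\beta_1,\beta_3)$-plane that is run through with unit speed along eight successive sides of lengths $a_1,a_2,a_3,a_4,a_1,a_2,a_3,a_4$, with directions $(0,-1)$, $(-\frac{\sqrt2}2,-\frac{\sqrt2}2)$, $(-1,0)$, $(-\frac{\sqrt2}2,\frac{\sqrt2}2)$, $(0,1)$, $(\frac{\sqrt2}2,\frac{\sqrt2}2)$, $(1,0)$, $(\frac{\sqrt2}2,-\frac{\sqrt2}2)$. The *counterclockwise* stroke is the same curve run backwards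 from the same vertex. Let $P=2(a_1+a_2+a_3+a_4)$, $|a|=\max_i a_i$, $\sigma=1$ for the counterclockwise and $\sigma=-1$ for the clockwise stroke, and $$C=\tfrac{\sqrt2}{2}a_1a_2+a_1a_3+\tfrac{\sqrt2}{2}a_2a_3+\tfrac{\sqrt2}{2}a_1a_4+a_2a_4+\tfrac{\sqrt2}{2}a_3a_4 .$$ **Theorem.** 1. $A(z)$ is invertible for every $z$, and for every $a$ with $a_i\ge0$, either sense and every initial state, the stroke drives a motion $z$ on $[0,P]$ that starts there. 2. For either sense and every initial state $z(0)$, $$z(P)-z(0)=\sigma\,C\,[g_1,g_2](z(0))+O(|a|^3)\qquad(a\to0).$$ 3. For all $x,y$, with $e_x=(0,0,1,0,0)$, $$[g_1,g_2](0,0,x,y,0)=\frac{\eta-\xi}{\xi}\,\frac{L^3L_2(3L+2L_2)}{(2L+L_2)^4}\;e_x .$$ 4. For either sense, if the stroke starts at $\theta=\beta_1=\beta_3=0$, then $$x(P)-x(0)=\sigma\,C\,\frac{\eta-\xi}{\xi}\,\frac{L^3L_2(3L+2L_2)}{(2L+L_2)^4}+o(|a|^3)\qquad(a\to0).$$ 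-/

import Mathlib

open Matrix Set

noncomputable section

namespace Purcell

/-- Parameters of the three-link swimmer: `L` is the length of each external arm, `L₂` the length of
the central link, `ξ` and `η` are the parallel and the perpendicular drag coefficient. -/
structure Swimmer where
  L : ℝ
  L₂ : ℝ
  ξ : ℝ
  η : ℝ

/-- A state `z = (β₁, β₃, x, y, θ)`. -/
abbrev State := Fin 5 → ℝ

/-- The unit vector at angle `φ` from the x-axis. -/
def ePar (φ : ℝ) : Fin 2 → ℝ := ![Real.cos φ, Real.sin φ]

/-- The unit vector `ePar φ` rotated by a quarter turn counterclockwise. -/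
def ePerp (φ : ℝ) : Fin 2 → ℝ := ![-Real.sin φ, Real.cos φ]

/-- Angle between the x-axis and each link; the indices 0, 1, 2 are links 1, 2, 3, and link 2 is the
central one. -/
def linkAngle (z : State) : Fin 3 → ℝ := ![z 4 - z 0, z 4, z 4 - z 1]

/-- The lengths of the three links. -/
def linkLength (S : Swimmer) : Fin 3 → ℝ := ![S.L, S.L₂, S.L]

/-- The position, relative to the center of the central link, of the point at distance `s` from the
extremity of link `i`. -/
def relPos (S : Swimmer) (z : State) (i : Fin 3) (s : ℝ) : Fin 2 → ℝ :=
  ![-(S.L₂ / 2) • ePar (z 4) - s • ePar (z 4 - z 0),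
    -(s - S.L₂ / 2) • ePar (z 4),
    (S.L₂ / 2) • ePar (z 4) + s • ePar (z 4 - z 1)] i

/-- The velocity of that point, when `p = (x', y', θ')` is the velocity of the central link and
`w = (β₁', β₃')` is the rate of deformation. -/
def pointVel (S : Swimmer) (z : State) (p : Fin 3 → ℝ) (w : Fin 2 → ℝ) (i : Fin 3) (s : ℝ) :
    Fin 2 → ℝ :=
  ![![p 0, p 1] - (S.L₂ / 2 * p 2) • ePerp (z 4) - (s * (p 2 - w 0)) • ePerp (z 4 - z 0),
    ![p 0, p 1] - ((s - S.L₂ / 2) * p 2) • ePerp (z 4),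
    ![p 0, p 1] + (S.L₂ / 2 * p 2) • ePerp (z 4) + (s * (p 2 - w 1)) • ePerp (z 4 - z 1)] i

/-- The density of the drag force on link `i`, given by resistive force theory. -/
def dragForce (S : Swimmer) (z : State) (p : Fin 3 → ℝ) (w : Fin 2 → ℝ) (i : Fin 3) (s : ℝ) :
    Fin 2 → ℝ :=
  -(S.ξ * (pointVel S z p w i s ⬝ᵥ ePar (linkAngle z i))) • ePar (linkAngle z i)
    - (S.η * (pointVel S z p w i s ⬝ᵥ ePerp (linkAngle z i))) • ePerp (linkAngle z i)

/-- The total force on the swimmer. -/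
def totalForce (S : Swimmer) (z : State) (p : Fin 3 → ℝ) (w : Fin 2 → ℝ) (k : Fin 2) : ℝ :=
  ∑ i : Fin 3, ∫ s in (0 : ℝ)..linkLength S i, dragForce S z p w i s k

/-- The total torque on the swimmer with respect to the center of the central link. -/
def totalTorque (S : Swimmer) (z : State) (p : Fin 3 → ℝ) (w : Fin 2 → ℝ) : ℝ :=
  ∑ i : Fin 3, ∫ s in (0 : ℝ)..linkLength S i,
    (relPos S z i s 0 * dragForce S z p w i s 1 - relPos S z i s 1 * dragForce S z p w i s 0)

/-- The two components of the total force and the total torque. Newton's laws, inertia being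
neglected, say that this vector vanishes. -/
def resultant (S : Swimmer) (z : State) (p : Fin 3 → ℝ) (w : Fin 2 → ℝ) : Fin 3 → ℝ :=
  ![totalForce S z p w 0, totalForce S z p w 1, totalTorque S z p w]

/-- The grand resistance matrix. -/
def matA (S : Swimmer) (z : State) : Matrix (Fin 3) (Fin 3) ℝ :=
  Matrix.of fun i j => resultant S z (Pi.single j 1) 0 i

/-- The matrix of the part of the resultant due to the deformation, with the opposite sign. -/
def matB (S : Swimmer) (z : State) : Matrix (Fin 3) (Fin 2) ℝ :=
  Matrix.of fun i j => -resultant S z 0 (Pi.single j 1) i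

/-- Position and velocity of a point of the swimmer are consistent. -/
theorem hasDerivAt_position (S : Swimmer) (z : ℝ → State) (z' : State) (t : ℝ)
    (hz : HasDerivAt z z' t) (i : Fin 3) (s : ℝ) :
    HasDerivAt (fun τ => ![z τ 2, z τ 3] + relPos S (z τ) i s)
      (pointVel S (z t) ![z' 2, z' 3, z' 4] ![z' 0, z' 1] i s) t := by
  have h := hasDerivAt_pi.1 hz
  have h0 := h 0
  have h1 := h 1
  have h2 := h 2
  have h3 := h 3
  have h4 := h 4
  have c4 := h4.cos
  have s4 := h4.sin
  have c0 := (h4.sub h0).cos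
  have s0 := (h4.sub h0).sin
  have c1 := (h4.sub h1).cos
  have s1 := (h4.sub h1).sin
  rw [hasDerivAt_pi]
  intro k
  fin_cases i <;> fin_cases k <;>
    simp [relPos, pointVel, ePar, ePerp]
  · refine ((h2.add ((c4.const_mul (S.L₂ / 2)).neg.sub (c0.const_mul s)))).congr_deriv ?_
    simp; ring
  · refine ((h3.add ((s4.const_mul (S.L₂ / 2)).neg.sub (s0.const_mul s)))).congr_deriv ?_
    simp; ring
  · refine (h2.add (c4.const_mul (S.L₂ / 2 - s))).congr_deriv ?_
    ring
  · refine (h3.add (s4.const_mul (S.L₂ / 2 - s))).congr_deriv ?_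
    ring
  · refine (h2.add ((c4.const_mul (S.L₂ / 2)).add (c1.const_mul s))).congr_deriv ?_
    simp; ring
  · refine (h3.add ((s4.const_mul (S.L₂ / 2)).add (s1.const_mul s))).congr_deriv ?_
    simp; ring

theorem pointVel_eq (S : Swimmer) (z : State) (p : Fin 3 → ℝ) (w : Fin 2 → ℝ) (i : Fin 3) (s : ℝ)
    (k : Fin 2) : pointVel S z p w i s k =
      (∑ j, p j * pointVel S z (Pi.single j 1) 0 i s k)
        + ∑ j, w j * pointVel S z 0 (Pi.single j 1) i s k := by
  fin_cases i <;> fin_cases k <;>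
    simp [pointVel, vecHead, vecTail, Fin.sum_univ_three, Pi.single_apply] <;> ring

theorem dragForce_eq (S : Swimmer) (z : State) (p : Fin 3 → ℝ) (w : Fin 2 → ℝ) (i : Fin 3) (s : ℝ)
    (k : Fin 2) : dragForce S z p w i s k =
      (∑ j, p j * dragForce S z (Pi.single j 1) 0 i s k)
        + ∑ j, w j * dragForce S z 0 (Pi.single j 1) i s k := by
  simp only [dragForce, dotProduct, Fin.sum_univ_two, Fin.sum_univ_three, Pi.sub_apply,
    Pi.smul_apply, smul_eq_mul, pointVel_eq S z p w i s]
  ring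

theorem continuous_pointVel (S : Swimmer) (z : State) (p : Fin 3 → ℝ) (w : Fin 2 → ℝ) (i : Fin 3)
    (k : Fin 2) : Continuous fun s => pointVel S z p w i s k := by
  fin_cases i <;> fin_cases k <;> simp [pointVel, vecHead, vecTail] <;> fun_prop

theorem continuous_dragForce (S : Swimmer) (z : State) (p : Fin 3 → ℝ) (w : Fin 2 → ℝ) (i : Fin 3)
    (k : Fin 2) : Continuous fun s => dragForce S z p w i s k := by
  have h := continuous_pointVel S z p w i
  simp only [dragForce, dotProduct, Fin.sum_univ_two, Pi.sub_apply,
    Pi.smul_apply, smul_eq_mul]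
  have h0 := h 0
  have h1 := h 1
  fun_prop

theorem continuous_relPos (S : Swimmer) (z : State) (i : Fin 3) (k : Fin 2) :
    Continuous fun s => relPos S z i s k := by
  fin_cases i <;> simp [relPos] <;> fun_prop

/-- The resultant is `A(z) p - B(z) w`. Hence, where `A(z)` is invertible, Newton's laws say that
`p = A(z)⁻¹ B(z) w`. -/
theorem resultant_eq (S : Swimmer) (z : State) (p : Fin 3 → ℝ) (w : Fin 2 → ℝ) :
    resultant S z p w = matA S z *ᵥ p - matB S z *ᵥ w := by
  have hF : ∀ k, totalForce S z p w k = (∑ j, p j * totalForce S z (Pi.single j 1) 0 k)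
      + ∑ j, w j * totalForce S z 0 (Pi.single j 1) k := by
    intro k
    have hi : ∀ p w i (c : ℝ), IntervalIntegrable (fun s => c * dragForce S z p w i s k)
        MeasureTheory.volume 0 (linkLength S i) := fun p w i c =>
      ((continuous_dragForce S z p w i k).const_mul c).intervalIntegrable _ _
    have key : ∀ i, ∫ s in (0 : ℝ)..linkLength S i, dragForce S z p w i s k =
        (∑ j, p j * ∫ s in (0 : ℝ)..linkLength S i, dragForce S z (Pi.single j 1) 0 i s k)
        + ∑ j, w j * ∫ s in (0 : ℝ)..linkLength S i, dragForce S z 0 (Pi.single j 1) i s k := by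
      intro i
      simp_rw [dragForce_eq S z p w i _ k]
      rw [intervalIntegral.integral_add, intervalIntegral.integral_finsetSum,
        intervalIntegral.integral_finsetSum]
      · simp only [intervalIntegral.integral_const_mul]
      · exact fun j _ => hi _ _ _ _
      · exact fun j _ => hi _ _ _ _
      · simp only [Fin.sum_univ_three]
        exact ((hi _ _ _ _).add (hi _ _ _ _)).add (hi _ _ _ _)
      · simp only [Fin.sum_univ_two]
        exact (hi _ _ _ _).add (hi _ _ _ _)
    simp only [totalForce, key, Fin.sum_univ_succ, Fin.sum_univ_zero]
    ring
  have hT : totalTorque S z p w = (∑ j, p j * totalTorque S z (Pi.single j 1) 0)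
      + ∑ j, w j * totalTorque S z 0 (Pi.single j 1) := by
    have hi : ∀ p w i (c : ℝ), IntervalIntegrable (fun s => c * (relPos S z i s 0 *
        dragForce S z p w i s 1 - relPos S z i s 1 * dragForce S z p w i s 0))
        MeasureTheory.volume 0 (linkLength S i) := fun p w i c =>
      ((((continuous_relPos S z i 0).mul (continuous_dragForce S z p w i 1)).sub
        ((continuous_relPos S z i 1).mul
          (continuous_dragForce S z p w i 0))).const_mul c).intervalIntegrable _ _
    have e : ∀ i s, relPos S z i s 0 * dragForce S z p w i s 1
          - relPos S z i s 1 * dragForce S z p w i s 0 =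
        (∑ j, p j * (relPos S z i s 0 * dragForce S z (Pi.single j 1) 0 i s 1
          - relPos S z i s 1 * dragForce S z (Pi.single j 1) 0 i s 0))
        + ∑ j, w j * (relPos S z i s 0 * dragForce S z 0 (Pi.single j 1) i s 1
          - relPos S z i s 1 * dragForce S z 0 (Pi.single j 1) i s 0) := by
      intro i s
      rw [dragForce_eq S z p w i s 0, dragForce_eq S z p w i s 1]
      simp only [Fin.sum_univ_succ, Fin.sum_univ_zero]
      ring
    have key : ∀ i, ∫ s in (0 : ℝ)..linkLength S i, (relPos S z i s 0 * dragForce S z p w i s 1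
          - relPos S z i s 1 * dragForce S z p w i s 0) =
        (∑ j, p j * ∫ s in (0 : ℝ)..linkLength S i,
          (relPos S z i s 0 * dragForce S z (Pi.single j 1) 0 i s 1
            - relPos S z i s 1 * dragForce S z (Pi.single j 1) 0 i s 0))
        + ∑ j, w j * ∫ s in (0 : ℝ)..linkLength S i,
          (relPos S z i s 0 * dragForce S z 0 (Pi.single j 1) i s 1
            - relPos S z i s 1 * dragForce S z 0 (Pi.single j 1) i s 0) := by
      intro i
      simp_rw [e i]
      rw [intervalIntegral.integral_add, intervalIntegral.integral_finsetSum,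
        intervalIntegral.integral_finsetSum]
      · simp only [intervalIntegral.integral_const_mul]
      · exact fun j _ => hi _ _ _ _
      · exact fun j _ => hi _ _ _ _
      · simp only [Fin.sum_univ_three]
        exact ((hi _ _ _ _).add (hi _ _ _ _)).add (hi _ _ _ _)
      · simp only [Fin.sum_univ_two]
        exact (hi _ _ _ _).add (hi _ _ _ _)
    simp only [totalTorque, key, Fin.sum_univ_succ, Fin.sum_univ_zero]
    ring
  ext i
  fin_cases i <;>
    simp [resultant, matA, matB, mulVec, dotProduct, hF, hT, Fin.sum_univ_succ] <;> ring

/-- The control vector fields `g₁` (`j = 0`) and `g₂` (`j = 1`): the columns of the matrix obtained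
by putting the identity above `A⁻¹ B`. -/
def g (S : Swimmer) (j : Fin 2) (z : State) : State :=
  ![(1 : Matrix (Fin 2) (Fin 2) ℝ) 0 j, (1 : Matrix (Fin 2) (Fin 2) ℝ) 1 j,
    ((matA S z)⁻¹ * matB S z) 0 j, ((matA S z)⁻¹ * matB S z) 1 j, ((matA S z)⁻¹ * matB S z) 2 j]

/-- The sense in which the octagon is traversed in the `(β₁, β₃)` plane. -/
inductive Sense where
  | counterclockwise
  | clockwise

/-- `1` for counterclockwise and `-1` for clockwise. -/
def Sense.sign : Sense → ℝ
  | .counterclockwise => 1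
  | .clockwise => -1

/-- The control `(β₁', β₃')` on the successive sides of the octagon. Clockwise, the sides are
traversed in the order `a₁, a₂, a₃, a₄, a₁, a₂, a₃, a₄`; counterclockwise, the same closed curve is
run backwards from the same vertex. -/
def octagonControl : Sense → Fin 8 → Fin 2 → ℝ
  | .clockwise =>
    ![![0, -1], ![-(√2 / 2), -(√2 / 2)], ![-1, 0], ![-(√2 / 2), √2 / 2],
      ![0, 1], ![√2 / 2, √2 / 2], ![1, 0], ![√2 / 2, -(√2 / 2)]]
  | .counterclockwise =>
    ![![-(√2 / 2), √2 / 2], ![-1, 0], ![-(√2 / 2), -(√2 / 2)], ![0, -1],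
      ![√2 / 2, -(√2 / 2)], ![1, 0], ![√2 / 2, √2 / 2], ![0, 1]]

/-- The lengths of the successive sides of the octagon. -/
def octagonSide (a : Fin 4 → ℝ) : Sense → Fin 8 → ℝ
  | .clockwise => ![a 0, a 1, a 2, a 3, a 0, a 1, a 2, a 3]
  | .counterclockwise => ![a 3, a 2, a 1, a 0, a 3, a 2, a 1, a 0]

/-- The arc-length at which the side number `k` begins (sides being numbered from 0). -/
def octagonNode (a : Fin 4 → ℝ) (o : Sense) (k : ℕ) : ℝ :=
  ∑ j : Fin 8 with j.val < k, octagonSide a o j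

/-- The perimeter of the octagon. -/
def perimeter (a : Fin 4 → ℝ) : ℝ := 2 * (a 0 + a 1 + a 2 + a 3)

/-- `z` is the motion of the swimmer, as a function of the arc-length on `[0, perimeter a]`, that
starts at `z₀` and is driven by the octagonal stroke: on each side the equation
`z' = β₁' g₁(z) + β₃' g₂(z)` holds up to the end points (one-sided derivatives there). -/
structure IsStrokeMotion (S : Swimmer) (a : Fin 4 → ℝ) (o : Sense) (z₀ : State) (z : ℝ → State) :
    Prop where
  init : z 0 = z₀
  ode : ∀ k : Fin 8, ∀ t ∈ Icc (octagonNode a o k.val) (octagonNode a o (k.val + 1)),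
    HasDerivWithinAt z (octagonControl o k 0 • g S 0 (z t) + octagonControl o k 1 • g S 1 (z t))
      (Icc (octagonNode a o k.val) (octagonNode a o (k.val + 1))) t

/-- The quadratic form `C` in the side lengths. -/
def strokeC (a : Fin 4 → ℝ) : ℝ :=
  a 0 * a 1 * √2 / 2 + a 0 * a 2 + a 1 * a 2 * √2 / 2 + a 0 * a 3 * √2 / 2 + a 1 * a 3
    + a 2 * a 3 * √2 / 2

/-- The x-component of the Lie bracket at `θ = β₁ = β₃ = 0`. -/
def bracketCoeff (S : Swimmer) : ℝ :=
  (S.η - S.ξ) / S.ξ * (S.L ^ 3 * S.L₂ * (3 * S.L + 2 * S.L₂) / (2 * S.L + S.L₂) ^ 4)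

end Purcell

end

/-! The drag is linear in the velocities and dissipates energy: the power of the total force and
torque in a rigid motion is minus a positively weighted integral of squared velocities. If `matA S z
*ᵥ p = 0`, the central link is therefore at rest, so `p = 0`; this gives invertibility
(`isUnit_det_matA`). Hence the control fields are smooth, and they are bounded because they depend
only on the link angles modulo `2π`. Picard–Lindelöf, applied side after side, then produces the
motion.

Let `β` be the displacement of the shape from its initial value. Iterating the integral equation
twice gives `z(P) - z(0) = ∑ β_j(P) g_j + ∑ (∫ β_i dβ_j) Dg_j·g_i` plus a remainder of order three.
The octagon is closed, so the first sum drops out, and the matrix of the `∫ β_i dβ_j` is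
antisymmetric with the signed area `σC` off the diagonal: the second sum is `σC [g₁, g₂]`.

Reflection in the x-axis makes the x-component of each field odd about a straight state and the
other components even. So every component of the bracket except x vanishes there, and the
x-component follows from differentiating the balance of x-forces. Parity also makes the even
components constant up to second order and the remainder of the odd one cubic. Since the fields do
not depend on `x`, the x-displacement then has a remainder of order four. `stroke_expansion` serves
both orders through two projections `π` and `φ`. -/

noncomputable section

namespace Purcell

/-! ### Force and torque as finite sums. -/

/-- Simpson's rule on `[0, l]`. -/
def simpson (l : ℝ) (f : ℝ → ℝ) : ℝ := l / 6 * (f 0 + 4 * f (l / 2) + f l)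

/-- Along a link, the force density is affine and the torque density quadratic in `s`. Simpson's
rule is exact for both, so every integral becomes an explicit expression that can be expanded,
bounded and differentiated. -/
theorem integral_eq_simpson {f : ℝ → ℝ} {a b c : ℝ} (h : ∀ s, f s = a + b * s + c * s ^ 2) (l : ℝ) :
    ∫ s in (0 : ℝ)..l, f s = simpson l f := by
  have hi : ∀ g : ℝ → ℝ, Continuous g → IntervalIntegrable g MeasureTheory.volume 0 l :=
    fun g hg => hg.intervalIntegrable _ _
  simp only [h, simpson]
  rw [intervalIntegral.integral_add (hi _ (by fun_prop)) (hi _ (by fun_prop)),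
    intervalIntegral.integral_add (hi _ (by fun_prop)) (hi _ (by fun_prop))]
  rw [intervalIntegral.integral_const_mul b, intervalIntegral.integral_const_mul c, _root_.integral_id,
    integral_pow, intervalIntegral.integral_const, smul_eq_mul]
  push_cast
  ring

theorem pointVel_affine (S : Swimmer) (z : State) (p : Fin 3 → ℝ) (w : Fin 2 → ℝ) (i : Fin 3)
    (s : ℝ) (k : Fin 2) : pointVel S z p w i s k =
      pointVel S z p w i 0 k + s * (pointVel S z p w i 1 k - pointVel S z p w i 0 k) := by
  fin_cases i <;> fin_cases k <;> simp [pointVel, vecHead, vecTail] <;> ring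

theorem relPos_affine (S : Swimmer) (z : State) (i : Fin 3) (s : ℝ) (k : Fin 2) :
    relPos S z i s k = relPos S z i 0 k + s * (relPos S z i 1 k - relPos S z i 0 k) := by
  fin_cases i <;> simp [relPos] <;> ring

theorem dragForce_affine (S : Swimmer) (z : State) (p : Fin 3 → ℝ) (w : Fin 2 → ℝ) (i : Fin 3)
    (s : ℝ) (k : Fin 2) : dragForce S z p w i s k =
      dragForce S z p w i 0 k + s * (dragForce S z p w i 1 k - dragForce S z p w i 0 k) := by
  simp only [dragForce, dotProduct, Fin.sum_univ_two, Pi.sub_apply, Pi.smul_apply, smul_eq_mul,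
    pointVel_affine S z p w i s]
  ring

theorem totalForce_eq_simpson (S : Swimmer) (z : State) (p : Fin 3 → ℝ) (w : Fin 2 → ℝ)
    (k : Fin 2) : totalForce S z p w k =
      ∑ i, simpson (linkLength S i) fun s => dragForce S z p w i s k := by
  refine Finset.sum_congr rfl fun i _ => integral_eq_simpson
    (a := dragForce S z p w i 0 k) (b := dragForce S z p w i 1 k - dragForce S z p w i 0 k)
    (c := 0) (fun s => ?_) _
  rw [dragForce_affine]
  ring

theorem totalTorque_eq_simpson (S : Swimmer) (z : State) (p : Fin 3 → ℝ) (w : Fin 2 → ℝ) :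
    totalTorque S z p w = ∑ i, simpson (linkLength S i) fun s =>
      relPos S z i s 0 * dragForce S z p w i s 1 - relPos S z i s 1 * dragForce S z p w i s 0 := by
  refine Finset.sum_congr rfl fun i _ => integral_eq_simpson
    (a := relPos S z i 0 0 * dragForce S z p w i 0 1 - relPos S z i 0 1 * dragForce S z p w i 0 0)
    (b := relPos S z i 0 0 * (dragForce S z p w i 1 1 - dragForce S z p w i 0 1)
      + (relPos S z i 1 0 - relPos S z i 0 0) * dragForce S z p w i 0 1
      - relPos S z i 0 1 * (dragForce S z p w i 1 0 - dragForce S z p w i 0 0)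
      - (relPos S z i 1 1 - relPos S z i 0 1) * dragForce S z p w i 0 0)
    (c := (relPos S z i 1 0 - relPos S z i 0 0) * (dragForce S z p w i 1 1 - dragForce S z p w i 0 1)
      - (relPos S z i 1 1 - relPos S z i 0 1) * (dragForce S z p w i 1 0 - dragForce S z p w i 0 0))
    (fun s => ?_) _
  rw [dragForce_affine S z p w i s 0, dragForce_affine S z p w i s 1, relPos_affine S z i s 0,
    relPos_affine S z i s 1]
  ring

/-! ### Dissipation and invertibility of the resistance matrix. -/

/-- The power of the drag force in a rigid motion. -/
def power (S : Swimmer) (z : State) (p : Fin 3 → ℝ) (i : Fin 3) (s : ℝ) : ℝ :=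
  S.ξ * (pointVel S z p 0 i s ⬝ᵥ ePar (linkAngle z i)) ^ 2
    + S.η * (pointVel S z p 0 i s ⬝ᵥ ePerp (linkAngle z i)) ^ 2

theorem pointVel_rigid (S : Swimmer) (z : State) (p : Fin 3 → ℝ) (i : Fin 3) (s : ℝ) :
    pointVel S z p 0 i s 0 = p 0 - p 2 * relPos S z i s 1 ∧
      pointVel S z p 0 i s 1 = p 1 + p 2 * relPos S z i s 0 := by
  fin_cases i <;> simp [pointVel, relPos, ePar, ePerp, vecHead, vecTail] <;> constructor <;> ring

theorem power_eq (S : Swimmer) (z : State) (p : Fin 3 → ℝ) (i : Fin 3) (s : ℝ) :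
    p 0 * dragForce S z p 0 i s 0 + p 1 * dragForce S z p 0 i s 1
      + p 2 * (relPos S z i s 0 * dragForce S z p 0 i s 1
        - relPos S z i s 1 * dragForce S z p 0 i s 0) = -power S z p i s := by
  obtain ⟨h0, h1⟩ := pointVel_rigid S z p i s
  simp only [power, dragForce, dotProduct, Fin.sum_univ_two, Pi.sub_apply, Pi.smul_apply,
    smul_eq_mul, h0, h1]
  ring

/-- Force is dual to translation and torque to rotation, so pairing with `p` integrates force
density times velocity over the links. -/
theorem resultant_power (S : Swimmer) (z : State) (p : Fin 3 → ℝ) :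
    p ⬝ᵥ resultant S z p 0 = -∑ i, simpson (linkLength S i) (power S z p i) := by
  simp only [resultant, dotProduct, Fin.sum_univ_three, totalForce_eq_simpson,
    totalTorque_eq_simpson, simpson, ← neg_eq_iff_eq_neg.2 (power_eq S z p _ _)]
  simp
  ring

theorem power_nonneg {S : Swimmer} (hξ : 0 < S.ξ) (hη : 0 < S.η) (z : State) (p : Fin 3 → ℝ)
    (i : Fin 3) (s : ℝ) : 0 ≤ power S z p i s := by
  unfold power; positivity

theorem simpson_power_nonneg {S : Swimmer} (hL : 0 < S.L) (hL₂ : 0 < S.L₂) (hξ : 0 < S.ξ)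
    (hη : 0 < S.η) (z : State) (p : Fin 3 → ℝ) (i : Fin 3) :
    0 ≤ simpson (linkLength S i) (power S z p i) := by
  have h := power_nonneg hξ hη z p i
  have hl : 0 ≤ linkLength S i := by fin_cases i <;> simp [linkLength, hL.le, hL₂.le]
  have h0 := h 0
  have h1 := h (linkLength S i / 2)
  have h2 := h (linkLength S i)
  unfold simpson
  positivity

theorem eq_zero_of_resultant_eq_zero {S : Swimmer} (hL : 0 < S.L) (hL₂ : 0 < S.L₂) (hξ : 0 < S.ξ)
    (hη : 0 < S.η) {z : State} {p : Fin 3 → ℝ} (h : resultant S z p 0 = 0) : p = 0 := by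
  have hp := resultant_power S z p
  rw [h, dotProduct_zero, eq_comm, neg_eq_zero,
    Finset.sum_eq_zero_iff_of_nonneg fun i _ => simpson_power_nonneg hL hL₂ hξ hη z p i] at hp
  have h1 := hp 1 (Finset.mem_univ _)
  have n0 := power_nonneg hξ hη z p 1 0
  have n1 := power_nonneg hξ hη z p 1 (S.L₂ / 2)
  have n2 := power_nonneg hξ hη z p 1 S.L₂
  simp only [simpson, linkLength, cons_val_one, cons_val_zero, mul_eq_zero, hL₂.ne', div_eq_zero_iff,
    OfNat.ofNat_ne_zero, or_false, false_or] at h1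
  -- Two points of the central link suffice: at the midpoint the lever arm is zero, so the
  -- difference of the transverse velocities isolates the rotation `p 2`.
  have e0 : power S z p 1 0 = 0 := by linarith
  have e1 : power S z p 1 (S.L₂ / 2) = 0 := by linarith
  have cs := Real.sin_sq_add_cos_sq (z 4)
  have key : ∀ s, power S z p 1 s = 0 → p 0 * Real.cos (z 4) + p 1 * Real.sin (z 4) = 0 ∧
      -p 0 * Real.sin (z 4) + p 1 * Real.cos (z 4) = (s - S.L₂ / 2) * p 2 := by
    intro s hs
    unfold power at hs
    have a1 : 0 ≤ S.ξ * (pointVel S z p 0 1 s ⬝ᵥ ePar (linkAngle z 1)) ^ 2 := by positivity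
    have a2 : 0 ≤ S.η * (pointVel S z p 0 1 s ⬝ᵥ ePerp (linkAngle z 1)) ^ 2 := by positivity
    obtain ⟨b1, b2⟩ := (add_eq_zero_iff_of_nonneg a1 a2).1 hs
    simp only [mul_eq_zero, hξ.ne', hη.ne', false_or, ne_eq, OfNat.ofNat_ne_zero,
      not_false_eq_true, pow_eq_zero_iff] at b1 b2
    simp [pointVel, dotProduct, Fin.sum_univ_two, ePar, ePerp, linkAngle, vecHead, vecTail] at b1 b2
    constructor
    · linear_combination b1
    · linear_combination b2 + (s - S.L₂ / 2) * p 2 * cs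
  obtain ⟨k1, k2⟩ := key _ e0
  obtain ⟨-, k3⟩ := key _ e1
  have k4 : p 2 = 0 := by
    have : S.L₂ / 2 * p 2 = 0 := by linarith
    simpa [hL₂.ne'] using this
  rw [k4] at k2
  ext i
  fin_cases i
  · simp only [Fin.zero_eta, Fin.isValue, Pi.zero_apply]
    linear_combination Real.cos (z 4) * k1 - Real.sin (z 4) * k2 - p 0 * cs
  · simp only [Fin.mk_one, Fin.isValue, Pi.zero_apply]
    linear_combination Real.sin (z 4) * k1 + Real.cos (z 4) * k2 - p 1 * cs
  · exact k4

theorem isUnit_det_matA {S : Swimmer} (hL : 0 < S.L) (hL₂ : 0 < S.L₂) (hξ : 0 < S.ξ)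
    (hη : 0 < S.η) (z : State) : IsUnit (matA S z).det := by
  rw [isUnit_iff_ne_zero]
  intro h
  obtain ⟨v, hv, h0⟩ := Matrix.exists_mulVec_eq_zero_iff.2 h
  refine hv (eq_zero_of_resultant_eq_zero hL hL₂ hξ hη (z := z) ?_)
  rw [resultant_eq, h0, mulVec_zero, sub_zero]

/-! ### Smoothness and boundedness of the control fields. -/

theorem contDiff_matA (S : Swimmer) (n : WithTop ℕ∞) (i j : Fin 3) :
    ContDiff ℝ n fun z => matA S z i j := by
  fin_cases i <;>
    simp [matA, resultant, totalForce_eq_simpson, totalTorque_eq_simpson, simpson, dragForce,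
      pointVel, relPos, ePar, ePerp, linkAngle, linkLength, dotProduct, Fin.sum_univ_succ, vecHead,
      vecTail] <;>
    fun_prop

theorem contDiff_matB (S : Swimmer) (n : WithTop ℕ∞) (i : Fin 3) (j : Fin 2) :
    ContDiff ℝ n fun z => matB S z i j := by
  fin_cases i <;>
    simp [matB, resultant, totalForce_eq_simpson, totalTorque_eq_simpson, simpson, dragForce,
      pointVel, relPos, ePar, ePerp, linkAngle, linkLength, dotProduct, Fin.sum_univ_succ, vecHead,
      vecTail] <;>
    fun_prop

theorem contDiff_g {S : Swimmer} (hL : 0 < S.L) (hL₂ : 0 < S.L₂) (hξ : 0 < S.ξ)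
    (hη : 0 < S.η) (n : WithTop ℕ∞) (j : Fin 2) : ContDiff ℝ n (g S j) := by
  have hA := contDiff_matA S n
  have hB := contDiff_matB S n
  have hinv : ∀ i j, ContDiff ℝ n fun z => (matA S z)⁻¹ i j := by
    intro i j
    have hd : ∀ z, (matA S z).det ≠ 0 := fun z => (isUnit_det_matA hL hL₂ hξ hη z).ne_zero
    have hdet : ContDiff ℝ n fun z => (matA S z).det := by
      simp only [det_fin_three]
      fun_prop
    have hadj : ContDiff ℝ n fun z => (matA S z).adjugate i j := by
      simp only [adjugate_fin_three]
      fin_cases i <;> fin_cases j <;> simp <;> fun_prop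
    simp only [inv_def, Ring.inverse_eq_inv', Matrix.smul_apply, smul_eq_mul]
    exact (hdet.inv hd).mul hadj
  have hprod : ∀ i, ContDiff ℝ n fun z => ((matA S z)⁻¹ * matB S z) i j := by
    intro i
    simp only [mul_apply]
    exact ContDiff.sum fun k _ => (hinv i k).mul (hB k j)
  rw [contDiff_pi]
  intro i
  fin_cases i <;> simp [g, contDiff_const, hprod]

/-- The velocity of the central link in the control vector field `g S j`. -/
def bodyVel (S : Swimmer) (j : Fin 2) (z : State) : Fin 3 → ℝ := ![g S j z 2, g S j z 3, g S j z 4]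

theorem resultant_bodyVel {S : Swimmer} (hL : 0 < S.L) (hL₂ : 0 < S.L₂) (hξ : 0 < S.ξ)
    (hη : 0 < S.η) (j : Fin 2) (z : State) :
    resultant S z (bodyVel S j z) (Pi.single j 1) = 0 := by
  have h : bodyVel S j z = ((matA S z)⁻¹ * matB S z) *ᵥ Pi.single j 1 := by
    ext i
    fin_cases i <;> simp [bodyVel, g]
  rw [resultant_eq, h, mulVec_mulVec, ← Matrix.mul_assoc,
    mul_nonsing_inv _ (isUnit_det_matA hL hL₂ hξ hη z), Matrix.one_mul, sub_self]

/-- Uniqueness of the force-free velocity: a candidate has only to be checked against the balance,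
and the matrix is never inverted explicitly. -/
theorem eq_bodyVel {S : Swimmer} (hL : 0 < S.L) (hL₂ : 0 < S.L₂) (hξ : 0 < S.ξ)
    (hη : 0 < S.η) {j : Fin 2} {z : State} {p : Fin 3 → ℝ}
    (hp : resultant S z p (Pi.single j 1) = 0) : bodyVel S j z = p := by
  rw [← sub_eq_zero]
  refine eq_zero_of_resultant_eq_zero hL hL₂ hξ hη (z := z) ?_
  have h := resultant_bodyVel hL hL₂ hξ hη j z
  rw [resultant_eq] at hp h ⊢
  rw [mulVec_sub, mulVec_zero, sub_zero, sub_eq_zero.1 hp, sub_eq_zero.1 h, sub_self]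

/-- The state enters only through the sines and cosines of the link angles. This yields both
periodicity in the angles and independence of the position. -/
theorem resultant_congr (S : Swimmer) {z z' : State}
    (h : ∀ i, ePar (linkAngle z i) = ePar (linkAngle z' i)) (p : Fin 3 → ℝ) (w : Fin 2 → ℝ) :
    resultant S z p w = resultant S z' p w := by
  have h0 := h 0
  have h1 := h 1
  have h2 := h 2
  simp [linkAngle, ePar] at h0 h1 h2
  simp [resultant, totalForce_eq_simpson, totalTorque_eq_simpson, simpson, dragForce,
      pointVel, relPos, ePar, ePerp, linkAngle, Fin.sum_univ_succ, h0, h1, h2]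

theorem g_congr (S : Swimmer) {z z' : State}
    (h : ∀ i, ePar (linkAngle z i) = ePar (linkAngle z' i)) (j : Fin 2) : g S j z = g S j z' := by
  have hA : matA S z = matA S z' := by
    unfold matA
    simp only [resultant_congr S h]
  have hB : matB S z = matB S z' := by
    unfold matB
    simp only [resultant_congr S h]
  rw [g, g, hA, hB]

theorem exists_norm_g_le {S : Swimmer} (hL : 0 < S.L) (hL₂ : 0 < S.L₂) (hξ : 0 < S.ξ)
    (hη : 0 < S.η) : ∃ M : ℝ, 0 < M ∧ ∀ j z, ‖g S j z‖ ≤ M := by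
  have hK : IsCompact (Set.pi univ fun _ : Fin 5 => Icc (0 : ℝ) (2 * Real.pi)) :=
    isCompact_univ_pi fun _ => isCompact_Icc
  have hb : ∀ j, ∃ M, ∀ z ∈ Set.pi univ fun _ : Fin 5 => Icc (0 : ℝ) (2 * Real.pi),
      ‖g S j z‖ ≤ M := fun j =>
    hK.exists_bound_of_continuousOn (contDiff_g hL hL₂ hξ hη 0 j).continuous.continuousOn
  choose M hM using hb
  -- The `1` makes the bound positive, since it is used later as a divisor.
  refine ⟨max 1 (max (M 0) (M 1)), by positivity, fun j z => ?_⟩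
  have hπ := Real.two_pi_pos
  -- All five coordinates are reduced to the compact cube; reducing `x` and `y` as well is harmless
  -- because the fields ignore them.
  let z' : State := fun i => z i - ⌊z i / (2 * Real.pi)⌋ * (2 * Real.pi)
  have hz' : z' ∈ Set.pi univ fun _ : Fin 5 => Icc (0 : ℝ) (2 * Real.pi) := by
    intro i _
    have h1 := Int.floor_le (z i / (2 * Real.pi))
    have h2 := Int.lt_floor_add_one (z i / (2 * Real.pi))
    rw [le_div_iff₀ hπ] at h1
    rw [div_lt_iff₀ hπ] at h2
    constructor
    · simp only [z']; linarith
    · simp only [z']; linarith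
  have hg : g S j z = g S j z' := by
    refine g_congr S (fun i => ?_) j
    have : ∃ n : ℤ, linkAngle z' i = linkAngle z i - n * (2 * Real.pi) := by
      fin_cases i
      · refine ⟨⌊z 4 / (2 * Real.pi)⌋ - ⌊z 0 / (2 * Real.pi)⌋, ?_⟩
        simp [linkAngle, z']; ring
      · exact ⟨⌊z 4 / (2 * Real.pi)⌋, by simp [linkAngle, z']⟩
      · refine ⟨⌊z 4 / (2 * Real.pi)⌋ - ⌊z 1 / (2 * Real.pi)⌋, ?_⟩
        simp [linkAngle, z']; ring
    obtain ⟨n, hn⟩ := this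
    rw [hn, ePar, ePar, Real.cos_sub_int_mul_two_pi, Real.sin_sub_int_mul_two_pi]
  rw [hg]
  refine (hM j z' hz').trans ?_
  fin_cases j <;> simp

/-! ### Reflection in the x-axis. -/

theorem relPos_reflect (S : Swimmer) {z z' : State} (h0 : z' 0 = -z 0) (h1 : z' 1 = -z 1)
    (h4 : z' 4 = -z 4) (i : Fin 3) (s : ℝ) :
    relPos S z' i s 0 = relPos S z i s 0 ∧ relPos S z' i s 1 = -relPos S z i s 1 := by
  have e0 : -z 4 - z' 0 = -(z 4 - z 0) := by rw [h0]; ring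
  have e1 : -z 4 - z' 1 = -(z 4 - z 1) := by rw [h1]; ring
  -- Without `neg_sub` the angles keep the form `-(z 4 - z 0)`, to which the parity of sine and
  -- cosine applies.
  fin_cases i <;> simp [relPos, ePar, e0, e1, h4, -neg_sub] <;> ring

theorem dragForce_reflect (S : Swimmer) {z z' : State} (h0 : z' 0 = -z 0) (h1 : z' 1 = -z 1)
    (h4 : z' 4 = -z 4) (p : Fin 3 → ℝ) (w : Fin 2 → ℝ) (i : Fin 3) (s : ℝ) :
    dragForce S z' ![-p 0, p 1, p 2] w i s 0 = -dragForce S z p w i s 0 ∧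
      dragForce S z' ![-p 0, p 1, p 2] w i s 1 = dragForce S z p w i s 1 := by
  have e0 : -z 4 - z' 0 = -(z 4 - z 0) := by rw [h0]; ring
  have e1 : -z 4 - z' 1 = -(z 4 - z 1) := by rw [h1]; ring
  fin_cases i <;>
    simp [dragForce, pointVel, ePar, ePerp, linkAngle, dotProduct, Fin.sum_univ_succ,
      vecHead, vecTail, e0, e1, h4, -neg_sub] <;> constructor <;> ring

/-- The mirror image of a motion `(p, w)` has velocity `(p 0, -p 1, -p 2)` and deformation rate
`-w`. Reversing it, by linearity, restores `w` and leaves the sign on `p 0` alone. -/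
theorem resultant_reflect (S : Swimmer) {z z' : State} (h0 : z' 0 = -z 0) (h1 : z' 1 = -z 1)
    (h4 : z' 4 = -z 4) (p : Fin 3 → ℝ) (w : Fin 2 → ℝ) :
    resultant S z' ![-p 0, p 1, p 2] w =
      ![-resultant S z p w 0, resultant S z p w 1, resultant S z p w 2] := by
  have hr := relPos_reflect S h0 h1 h4
  have hd := dragForce_reflect S h0 h1 h4 p w
  ext i
  fin_cases i <;>
    simp [resultant, totalForce, totalTorque, fun i s => (hr i s).1, fun i s => (hr i s).2,
      fun i s => (hd i s).1, fun i s => (hd i s).2]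

theorem bodyVel_reflect {S : Swimmer} (hL : 0 < S.L) (hL₂ : 0 < S.L₂) (hξ : 0 < S.ξ)
    (hη : 0 < S.η) (j : Fin 2) {z z' : State} (h0 : z' 0 = -z 0) (h1 : z' 1 = -z 1)
    (h4 : z' 4 = -z 4) :
    bodyVel S j z' = ![-bodyVel S j z 0, bodyVel S j z 1, bodyVel S j z 2] := by
  refine eq_bodyVel hL hL₂ hξ hη ?_
  rw [resultant_reflect S h0 h1 h4, resultant_bodyVel hL hL₂ hξ hη]
  ext i
  fin_cases i <;> simp

open Metric

/-! ### Taylor estimates for even and odd maps. -/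

section Taylor

variable {E F : Type*} [NormedAddCommGroup E] [NormedSpace ℝ E] [NormedAddCommGroup F]
  [NormedSpace ℝ F]

/-- If the derivative is within `K ‖x - x₀‖ ^ m` of the derivative at `x₀`, then the error of the
first order expansion is at most `K ‖x - x₀‖ ^ (m + 1)`. -/
theorem norm_sub_fderiv_le {f : E → F} {x₀ : E} {K r : ℝ} (hK : 0 ≤ K) {m : ℕ}
    (hf : Differentiable ℝ f)
    (h : ∀ x, ‖x - x₀‖ < r → ‖fderiv ℝ f x - fderiv ℝ f x₀‖ ≤ K * ‖x - x₀‖ ^ m) {x : E}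
    (hx : ‖x - x₀‖ < r) :
    ‖f x - f x₀ - fderiv ℝ f x₀ (x - x₀)‖ ≤ K * ‖x - x₀‖ ^ (m + 1) := by
  rw [pow_succ, ← mul_assoc]
  refine (convex_closedBall x₀ ‖x - x₀‖).norm_image_sub_le_of_norm_fderiv_le'
    (fun y _ => hf y) (fun y hy => ?_) (mem_closedBall_self (norm_nonneg _)) ?_
  · rw [mem_closedBall, dist_eq_norm] at hy
    refine (h y (hy.trans_lt hx)).trans ?_
    gcongr
  · rw [mem_closedBall, dist_eq_norm]

theorem exists_norm_sub_le {f : E → F} (hf : ContDiff ℝ 1 f) (x₀ : E) :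
    ∃ K > 0, ∃ r > 0, ∀ x, ‖x - x₀‖ < r → ‖f x - f x₀‖ ≤ K * ‖x - x₀‖ := by
  obtain ⟨K, t, ht, h⟩ := hf.contDiffAt.exists_lipschitzOnWith (x := x₀)
  obtain ⟨r, hr, hrt⟩ := Metric.mem_nhds_iff.1 ht
  -- The Lipschitz constant may be zero, hence the `+ 1`.
  refine ⟨K + 1, by positivity, r, hr, fun x hx => ?_⟩
  have h1 := h.norm_sub_le (hrt (by rwa [mem_ball, dist_eq_norm])) (mem_of_mem_nhds ht)
  refine h1.trans ?_
  gcongr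
  simp

theorem exists_norm_sub_fderiv_le {f : E → F} (hf : ContDiff ℝ 2 f) (x₀ : E) :
    ∃ K > 0, ∃ r > 0, ∀ x, ‖x - x₀‖ < r →
      ‖f x - f x₀ - fderiv ℝ f x₀ (x - x₀)‖ ≤ K * ‖x - x₀‖ ^ 2 := by
  obtain ⟨K, hK, r, hr, h⟩ :=
    exists_norm_sub_le (hf.fderiv_right (m := 1) (by norm_num)) x₀
  exact ⟨K, hK, r, hr, fun x hx => norm_sub_fderiv_le (m := 1) hK.le (hf.differentiable two_ne_zero)
    (by simpa using h) hx⟩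

/-- The derivative at the center of symmetry of an even function is zero. -/
theorem fderiv_eq_zero_of_even {f : E → F} {x₀ : E} (h : ∀ w, f (x₀ - w) = f (x₀ + w)) :
    fderiv ℝ f x₀ = 0 := by
  by_cases hd : DifferentiableAt ℝ f x₀
  · have h1 : HasFDerivAt (fun w => f (x₀ + w)) (fderiv ℝ f x₀) 0 := by
      have := (hasFDerivAt_id (𝕜 := ℝ) (0 : E)).const_add x₀
      exact HasFDerivAt.comp (g := f) (0 : E) (by simpa using hd.hasFDerivAt) this
    have h2 : HasFDerivAt (fun w => f (x₀ - w)) (-fderiv ℝ f x₀) 0 := by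
      have := (hasFDerivAt_id (𝕜 := ℝ) (0 : E)).const_sub x₀
      simpa [Function.comp_def] using
        HasFDerivAt.comp (g := f) (0 : E) (by simpa using hd.hasFDerivAt) this
    simp only [h] at h2
    have h3 := eq_neg_iff_add_eq_zero.1 (h1.unique h2)
    rw [← two_smul ℝ] at h3
    exact (smul_eq_zero.1 h3).resolve_left two_ne_zero
  · exact fderiv_zero_of_not_differentiableAt hd

theorem fderiv_even_of_odd {f : E → F} (hf : Differentiable ℝ f) {x₀ : E}
    (h : ∀ w, f (x₀ - w) = -f (x₀ + w)) (w : E) :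
    fderiv ℝ f (x₀ - w) = fderiv ℝ f (x₀ + w) := by
  have h1 : HasFDerivAt (fun w => f (x₀ + w)) (fderiv ℝ f (x₀ + w)) w :=
    HasFDerivAt.comp (g := f) w (hf _).hasFDerivAt ((hasFDerivAt_id (𝕜 := ℝ) w).const_add x₀)
  have h2 : HasFDerivAt (fun w => f (x₀ - w)) (-fderiv ℝ f (x₀ - w)) w := by
    simpa [Function.comp_def] using
      HasFDerivAt.comp (g := f) w (hf _).hasFDerivAt ((hasFDerivAt_id (𝕜 := ℝ) w).const_sub x₀)
  simp only [h] at h2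
  exact neg_injective (h2.unique h1.neg)

theorem exists_norm_sub_le_of_even {f : E → F} (hf : ContDiff ℝ 2 f) {x₀ : E}
    (h : ∀ w, f (x₀ - w) = f (x₀ + w)) :
    ∃ K > 0, ∃ r > 0, ∀ x, ‖x - x₀‖ < r → ‖f x - f x₀‖ ≤ K * ‖x - x₀‖ ^ 2 := by
  simpa [fderiv_eq_zero_of_even h] using exists_norm_sub_fderiv_le hf x₀

/-- The derivative of an odd map is even, hence constant up to second order; the mean value
inequality gains one more power. -/
theorem exists_norm_sub_fderiv_le_of_odd {f : E → F} (hf : ContDiff ℝ 3 f) {x₀ : E}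
    (h : ∀ w, f (x₀ - w) = -f (x₀ + w)) :
    ∃ K > 0, ∃ r > 0, ∀ x, ‖x - x₀‖ < r →
      ‖f x - f x₀ - fderiv ℝ f x₀ (x - x₀)‖ ≤ K * ‖x - x₀‖ ^ 3 := by
  have hd := hf.differentiable three_ne_zero
  obtain ⟨K, hK, r, hr, h⟩ := exists_norm_sub_le_of_even
    (hf.fderiv_right (m := 2) (by norm_num)) (fderiv_even_of_odd hd h)
  exact ⟨K, hK, r, hr, fun x hx => norm_sub_fderiv_le (m := 2) hK.le hd h hx⟩

end Taylor

/-! ### Expansion of motions driven by polygonal controls. -/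

section Polygon

variable {E F V : Type*} [NormedAddCommGroup E] [NormedSpace ℝ E] [NormedAddCommGroup F]
  [NormedSpace ℝ F] [NormedAddCommGroup V] [NormedSpace ℝ V]

/-- Mean value inequality for a function given piecewise. -/
theorem norm_le_of_piecewise {N : ℕ} {T : ℕ → ℝ} {f f' : ℕ → ℝ → V} {C : ℝ}
    (hT : ∀ k < N, T k ≤ T (k + 1))
    (h0 : f 0 (T 0) = 0) (hf : ∀ k, k + 1 < N → f (k + 1) (T (k + 1)) = f k (T (k + 1)))
    (hd : ∀ k < N, ∀ t ∈ Icc (T k) (T (k + 1)),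
      HasDerivWithinAt (f k) (f' k t) (Icc (T k) (T (k + 1))) t)
    (hb : ∀ k < N, ∀ t ∈ Icc (T k) (T (k + 1)), ‖f' k t‖ ≤ C) :
    ∀ k < N, ∀ t ∈ Icc (T k) (T (k + 1)), ‖f k t‖ ≤ C * (t - T 0) := by
  have step : ∀ k < N, ∀ t ∈ Icc (T k) (T (k + 1)), ‖f k t - f k (T k)‖ ≤ C * (t - T k) :=
    fun k hk => norm_image_sub_le_of_norm_deriv_le_segment' (hd k hk)
      fun t ht => hb k hk t (Ico_subset_Icc_self ht)
  intro k
  induction k with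
  | zero =>
    intro hk t ht
    simpa [h0] using step 0 hk t ht
  | succ k ih =>
    intro hk t ht
    have h1 := ih (by omega) (T (k + 1)) ⟨hT k (by omega), le_rfl⟩
    have h2 := step (k + 1) hk t ht
    rw [hf k hk] at h2
    have h3 := norm_sub_norm_le (f (k + 1) t) (f k (T (k + 1)))
    linarith

/-- The vertices of the polygonal control curve with velocity `u k` on `[T k, T (k + 1)]`. -/
def polygonVertex (T : ℕ → ℝ) (u : ℕ → Fin 2 → ℝ) (k : ℕ) (i : Fin 2) : ℝ :=
  ∑ l ∈ Finset.range k, (T (l + 1) - T l) * u l i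

/-- The integral of `βᵢ dβⱼ` along the polygonal control curve up to the vertex `k`. -/
def polygonArea (T : ℕ → ℝ) (u : ℕ → Fin 2 → ℝ) (k : ℕ) (i j : Fin 2) : ℝ :=
  ∑ l ∈ Finset.range k, u l j *
    (polygonVertex T u l i * (T (l + 1) - T l) + u l i * ((T (l + 1) - T l) ^ 2 / 2))

theorem polygonVertex_succ (T : ℕ → ℝ) (u : ℕ → Fin 2 → ℝ) (k : ℕ) (i : Fin 2) :
    polygonVertex T u (k + 1) i = polygonVertex T u k i + (T (k + 1) - T k) * u k i :=
  Finset.sum_range_succ _ _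

theorem polygonArea_succ (T : ℕ → ℝ) (u : ℕ → Fin 2 → ℝ) (k : ℕ) (i j : Fin 2) :
    polygonArea T u (k + 1) i j = polygonArea T u k i j + u k j *
      (polygonVertex T u k i * (T (k + 1) - T k) + u k i * ((T (k + 1) - T k) ^ 2 / 2)) :=
  Finset.sum_range_succ _ _

/-- Two controls, each at most 1 in absolute value: this is the source of the factors 2 in the
estimates below. -/
theorem norm_sum_smul_le {c : Fin 2 → ℝ} (hc : ∀ i, |c i| ≤ 1) {v : Fin 2 → V} {M : ℝ}
    (hv : ∀ i, ‖v i‖ ≤ M) : ‖∑ i, c i • v i‖ ≤ 2 * M := by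
  have h : ∀ i, ‖c i • v i‖ ≤ M := fun i => by
    rw [norm_smul, Real.norm_eq_abs]
    exact (mul_le_of_le_one_left (norm_nonneg _) (hc i)).trans (hv i)
  simpa using norm_sum_le_of_le Finset.univ fun i _ => h i

variable {N : ℕ} {T : ℕ → ℝ} {u : ℕ → Fin 2 → ℝ} {G : Fin 2 → E → E} {z : ℝ → E} {M : ℝ}

/-- A motion driven by a polygonal control curve does not go far. -/
theorem norm_sub_le_of_polygon (hT : ∀ k < N, T k ≤ T (k + 1)) (hT0 : T 0 = 0)
    (hu : ∀ k i, |u k i| ≤ 1)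
    (hz : ∀ k < N, ∀ t ∈ Icc (T k) (T (k + 1)),
      HasDerivWithinAt z (∑ i, u k i • G i (z t)) (Icc (T k) (T (k + 1))) t)
    (hM : ∀ i x, ‖G i x‖ ≤ M) :
    ∀ k < N, ∀ t ∈ Icc (T k) (T (k + 1)), ‖z t - z 0‖ ≤ 2 * M * t := by
  have := norm_le_of_piecewise (f := fun _ t => z t - z 0) hT (by simp [hT0]) (fun k hk => rfl)
    (fun k hk t ht => (hz k hk t ht).sub_const (z 0))
    (fun k hk t ht => norm_sum_smul_le (hu k) fun i => hM i (z t))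
  simpa [hT0] using this

/-- First order expansion, seen through `π`. -/
theorem norm_first_order_le_of_polygon (hT : ∀ k < N, T k ≤ T (k + 1)) (hT0 : T 0 = 0)
    (hu : ∀ k i, |u k i| ≤ 1)
    (hz : ∀ k < N, ∀ t ∈ Icc (T k) (T (k + 1)),
      HasDerivWithinAt z (∑ i, u k i • G i (z t)) (Icc (T k) (T (k + 1))) t)
    (π : E →L[ℝ] E) {C : ℝ}
    (hC : ∀ k < N, ∀ t ∈ Icc (T k) (T (k + 1)), ∀ i, ‖π (G i (z t) - G i (z 0))‖ ≤ C) :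
    ∀ k < N, ∀ t ∈ Icc (T k) (T (k + 1)),
      ‖π (z t - z 0) - ∑ i, (polygonVertex T u k i + (t - T k) * u k i) • π (G i (z 0))‖
        ≤ 2 * C * t := by
  have := norm_le_of_piecewise
    (f := fun k t =>
      π (z t - z 0) - ∑ i, (polygonVertex T u k i + (t - T k) * u k i) • π (G i (z 0)))
    (f' := fun k t => ∑ i, u k i • π (G i (z t) - G i (z 0))) (C := 2 * C) hT
    (by simp [hT0, polygonVertex])
    (fun k hk => by simp [polygonVertex_succ])
    (fun k hk t ht => ?_)
    (fun k hk t ht => norm_sum_smul_le (hu k) (hC k hk t ht))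
  · simpa [hT0] using this
  · have h1 := π.hasFDerivAt.comp_hasDerivWithinAt t ((hz k hk t ht).sub_const (z 0))
    have h2 : ∀ i, HasDerivWithinAt
        (fun t => (polygonVertex T u k i + (t - T k) * u k i) • π (G i (z 0)))
        (u k i • π (G i (z 0))) (Icc (T k) (T (k + 1))) t := fun i => by
      have := ((((hasDerivWithinAt_id t (Icc (T k) (T (k + 1)))).sub_const (T k)).mul_const
        (u k i)).const_add (polygonVertex T u k i)).smul_const (π (G i (z 0)))
      simpa using this
    refine (h1.sub (HasDerivWithinAt.fun_sum fun i _ => h2 i)).congr_deriv ?_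
    simp [smul_sub, Finset.sum_sub_distrib]

/-- Second order expansion, seen through `φ`. -/
theorem norm_second_order_le_of_polygon (hT : ∀ k < N, T k ≤ T (k + 1)) (hT0 : T 0 = 0)
    (hu : ∀ k i, |u k i| ≤ 1)
    (hz : ∀ k < N, ∀ t ∈ Icc (T k) (T (k + 1)),
      HasDerivWithinAt z (∑ i, u k i • G i (z t)) (Icc (T k) (T (k + 1))) t)
    (π : E →L[ℝ] E) (φ : E →L[ℝ] F) (D : Fin 2 → E →L[ℝ] F) {C C' B : ℝ}
    (hC0 : 0 ≤ C) (hD : ∀ i, ‖D i‖ ≤ B)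
    (hC : ∀ k < N, ∀ t ∈ Icc (T k) (T (k + 1)), ∀ i, ‖π (G i (z t) - G i (z 0))‖ ≤ C)
    (hC' : ∀ k < N, ∀ t ∈ Icc (T k) (T (k + 1)), ∀ i,
      ‖φ (G i (z t) - G i (z 0)) - D i (π (z t - z 0))‖ ≤ C')
    (hN : 0 < N) :
    ‖φ (z (T N) - z 0) - (∑ j, polygonVertex T u N j • φ (G j (z 0)))
      - ∑ j, ∑ i, polygonArea T u N i j • D j (π (G i (z 0)))‖
        ≤ 2 * (C' + B * (2 * C * T N)) * T N := by
  have hTN : ∀ n k, k + n = N → T k ≤ T N := by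
    intro n
    induction n with
    | zero => intro k hk; rw [← hk]; rfl
    | succ n ih =>
      intro k hk
      exact (hT k (by omega)).trans (ih (k + 1) (by omega))
  have first := norm_first_order_le_of_polygon hT hT0 hu hz π hC
  -- The function is the remainder of the expansion on each side. Its derivative compares the field
  -- at `z t` with the linearization `D` at the first-order approximation of the motion.
  have := norm_le_of_piecewise
    (f := fun k t => φ (z t - z 0)
      - (∑ j, (polygonVertex T u k j + (t - T k) * u k j) • φ (G j (z 0)))
      - ∑ j, ∑ i, (polygonArea T u k i j + u k j *
        (polygonVertex T u k i * (t - T k) + u k i * ((t - T k) ^ 2 / 2))) • D j (π (G i (z 0))))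
    (f' := fun k t => ∑ j, u k j • (φ (G j (z t) - G j (z 0))
      - D j (∑ i, (polygonVertex T u k i + (t - T k) * u k i) • π (G i (z 0)))))
    (C := 2 * (C' + B * (2 * C * T N))) hT
    (by simp [hT0, polygonVertex, polygonArea])
    (fun k hk => by simp [polygonVertex_succ, polygonArea_succ])
    (fun k hk t ht => ?_)
    (fun k hk t ht => norm_sum_smul_le (hu k) fun j => ?_)
  · obtain ⟨n, rfl⟩ : ∃ n, N = n + 1 := ⟨N - 1, by omega⟩
    have h := this n (by omega) (T (n + 1)) ⟨hT n (by omega), le_rfl⟩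
    simpa only [polygonVertex_succ, polygonArea_succ, hT0, sub_zero] using h
  · have h1 := φ.hasFDerivAt.comp_hasDerivWithinAt t ((hz k hk t ht).sub_const (z 0))
    have hid := (hasDerivWithinAt_id t (Icc (T k) (T (k + 1)))).sub_const (T k)
    have h2 : ∀ j, HasDerivWithinAt
        (fun t => (polygonVertex T u k j + (t - T k) * u k j) • φ (G j (z 0)))
        (u k j • φ (G j (z 0))) (Icc (T k) (T (k + 1))) t := fun j => by
      have := ((hid.mul_const (u k j)).const_add (polygonVertex T u k j)).smul_const (φ (G j (z 0)))
      simpa using this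
    have h3 : ∀ j i, HasDerivWithinAt
        (fun t => (polygonArea T u k i j + u k j *
          (polygonVertex T u k i * (t - T k) + u k i * ((t - T k) ^ 2 / 2))) • D j (π (G i (z 0))))
        ((u k j * (polygonVertex T u k i + (t - T k) * u k i)) • D j (π (G i (z 0))))
        (Icc (T k) (T (k + 1))) t := fun j i => by
      have := ((((hid.const_mul (polygonVertex T u k i)).add
        (((hid.pow 2).div_const 2).const_mul (u k i))).const_mul (u k j)).const_add
          (polygonArea T u k i j)).smul_const (D j (π (G i (z 0))))
      refine this.congr_deriv ?_
      congr 2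
      simp [mul_comm]
    refine ((h1.sub (HasDerivWithinAt.fun_sum fun j _ => h2 j)).sub
      (HasDerivWithinAt.fun_sum fun j _ => HasDerivWithinAt.fun_sum fun i _ => h3 j i)).congr_deriv ?_
    simp [smul_sub, Finset.sum_sub_distrib, smul_smul]
  -- The error of the linearization is split from the error of the first-order approximation, which
  -- `D j` transports.
  · have e : φ (G j (z t) - G j (z 0))
        - D j (∑ i, (polygonVertex T u k i + (t - T k) * u k i) • π (G i (z 0))) =
        (φ (G j (z t) - G j (z 0)) - D j (π (z t - z 0))) +
        D j (π (z t - z 0) - ∑ i, (polygonVertex T u k i + (t - T k) * u k i) • π (G i (z 0))) := by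
      rw [map_sub (D j)]
      abel
    rw [e]
    refine (norm_add_le _ _).trans (add_le_add (hC' k hk t ht j) ?_)
    have h4 : t ≤ T N := ht.2.trans (hTN (N - (k + 1)) (k + 1) (by omega))
    refine (D j).le_of_opNorm_le_of_le (hD j) ((first k hk t ht).trans ?_)
    gcongr

end Polygon

/-! ### Existence of stroke motions. -/

/-- A bounded `C¹` vector field on a finite-dimensional space has integral curves on every compact
interval. -/
theorem exists_integralCurve {E : Type*} [NormedAddCommGroup E] [NormedSpace ℝ E]
    [FiniteDimensional ℝ E] {F : E → E} (hF : ContDiff ℝ 1 F) {M : ℝ} (hM : ∀ x, ‖F x‖ ≤ M)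
    (x₀ : E) {s t : ℝ} (hst : s ≤ t) :
    ∃ y : ℝ → E, y s = x₀ ∧ ∀ τ ∈ Icc s t, HasDerivWithinAt y (F (y τ)) (Icc s t) τ := by
  have hM0 : 0 ≤ M := (norm_nonneg _).trans (hM x₀)
  have : ProperSpace E := FiniteDimensional.proper ℝ E
  obtain ⟨K, hK⟩ := (hF.locallyLipschitz.locallyLipschitzOn
    (s := closedBall x₀ (M * (t - s)))).exists_lipschitzOnWith_of_compact
      (isCompact_closedBall x₀ (M * (t - s)))
  have hp : 0 ≤ M * (t - s) := mul_nonneg hM0 (sub_nonneg.2 hst)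
  -- At speed at most `M` a curve cannot leave the ball of radius `M * (t - s)`, so one application
  -- covers the whole interval.
  have h : IsPicardLindelof (fun _ => F) (tmin := s) (tmax := t) ⟨s, le_rfl, hst⟩ x₀
      ⟨M * (t - s), hp⟩ 0 ⟨M, hM0⟩ K :=
    IsPicardLindelof.of_time_independent (fun x _ => hM x) hK
      (by simp only [sub_self, NNReal.coe_zero, sub_zero, max_eq_left (sub_nonneg.2 hst)]; rfl)
  exact h.exists_eq_forall_mem_Icc_hasDerivWithinAt₀

theorem octagonNode_zero (a : Fin 4 → ℝ) (o : Sense) : octagonNode a o 0 = 0 := by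
  simp [octagonNode]

theorem octagonNode_succ (a : Fin 4 → ℝ) (o : Sense) (k : Fin 8) :
    octagonNode a o (k.val + 1) = octagonNode a o k.val + octagonSide a o k := by
  have h : (Finset.univ.filter fun j : Fin 8 => j.val < k.val + 1) =
      insert k (Finset.univ.filter fun j : Fin 8 => j.val < k.val) := by
    ext j
    simp [Fin.ext_iff]
    omega
  rw [octagonNode, h, Finset.sum_insert (by simp), add_comm, octagonNode]

theorem octagonSide_nonneg {a : Fin 4 → ℝ} (ha : ∀ i, 0 ≤ a i) (o : Sense) (k : Fin 8) :
    0 ≤ octagonSide a o k := by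
  cases o <;> fin_cases k <;> simp [octagonSide, ha]

theorem octagonNode_le_succ {a : Fin 4 → ℝ} (ha : ∀ i, 0 ≤ a i) (o : Sense) (k : Fin 8) :
    octagonNode a o k.val ≤ octagonNode a o (k.val + 1) := by
  rw [octagonNode_succ]
  exact le_add_of_nonneg_right (octagonSide_nonneg ha o k)

theorem octagonNode_mono {a : Fin 4 → ℝ} (ha : ∀ i, 0 ≤ a i) (o : Sense) :
    Monotone (octagonNode a o) := fun _ _ hmn =>
  Finset.sum_le_sum_of_subset_of_nonneg
    (fun _ hj => by simp only [Finset.mem_filter] at hj ⊢; exact ⟨hj.1, hj.2.trans_le hmn⟩)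
    fun j _ _ => octagonSide_nonneg ha o j

theorem octagonNode_eight (a : Fin 4 → ℝ) (o : Sense) : octagonNode a o 8 = perimeter a := by
  have h : (Finset.univ.filter fun j : Fin 8 => j.val < 8) = Finset.univ := by
    ext j; simp
  rw [octagonNode, h]
  cases o <;> simp [Fin.sum_univ_succ, octagonSide, perimeter] <;> ring

theorem abs_octagonControl_le (o : Sense) (k : Fin 8) (i : Fin 2) : |octagonControl o k i| ≤ 1 := by
  have h : √2 ≤ 2 := by rw [Real.sqrt_le_left] <;> norm_num
  have h0 := Real.sqrt_nonneg 2
  rw [abs_le]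
  cases o <;> fin_cases k <;> fin_cases i <;> simp [octagonControl] <;> (try constructor) <;>
    linarith

theorem exists_isStrokeMotion {S : Swimmer} (hL : 0 < S.L) (hL₂ : 0 < S.L₂) (hξ : 0 < S.ξ)
    (hη : 0 < S.η) (o : Sense) (z₀ : State) {a : Fin 4 → ℝ} (ha : ∀ i, 0 ≤ a i) :
    ∃ z : ℝ → State, IsStrokeMotion S a o z₀ z := by
  obtain ⟨M, hM0, hM⟩ := exists_norm_g_le hL hL₂ hξ hη
  -- Induction on the number of sides already run. Each new side is solved from the current end
  -- point and glued at the node, where both curves agree.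
  suffices h : ∀ n ≤ 8, ∃ z : ℝ → State, z 0 = z₀ ∧ ∀ k : Fin 8, k.val < n →
      ∀ t ∈ Icc (octagonNode a o k.val) (octagonNode a o (k.val + 1)),
      HasDerivWithinAt z (octagonControl o k 0 • g S 0 (z t) + octagonControl o k 1 • g S 1 (z t))
        (Icc (octagonNode a o k.val) (octagonNode a o (k.val + 1))) t by
    obtain ⟨z, h0, h⟩ := h 8 le_rfl
    exact ⟨z, h0, fun k => h k k.isLt⟩
  intro n
  induction n with
  | zero => exact fun _ => ⟨fun _ => z₀, rfl, fun k hk => absurd hk (Nat.not_lt_zero _)⟩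
  | succ n ih =>
    intro hn
    obtain ⟨z, hz0, hz⟩ := ih (by omega)
    let c := octagonControl o ⟨n, hn⟩
    have hle := octagonNode_le_succ ha o ⟨n, hn⟩
    obtain ⟨y, hy0, hy⟩ := exists_integralCurve (F := fun x => c 0 • g S 0 x + c 1 • g S 1 x)
      (M := M + M) (((contDiff_g hL hL₂ hξ hη 1 0).const_smul _).add
        ((contDiff_g hL hL₂ hξ hη 1 1).const_smul _))
      (fun x => by
        have h : ∀ i, ‖c i • g S i x‖ ≤ M := fun i => by
          rw [norm_smul, Real.norm_eq_abs]
          exact (mul_le_of_le_one_left (norm_nonneg _) (abs_octagonControl_le _ _ i)).trans (hM i x)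
        exact norm_add_le_of_le (h 0) (h 1))
      (z (octagonNode a o n)) hle
    let y' : ℝ → State := fun t => if t ≤ octagonNode a o n then z t else y t
    have hy1 : ∀ t, t ≤ octagonNode a o n → y' t = z t := fun t ht => if_pos ht
    have hy2 : ∀ t, octagonNode a o n ≤ t → y' t = y t := fun t ht => by
      rcases ht.eq_or_lt with rfl | ht
      · rw [hy1 _ le_rfl, hy0]
      · exact if_neg ht.not_ge
    refine ⟨y', ?_, fun k hk t ht => ?_⟩
    · rw [hy1 _ (by rw [← octagonNode_zero a o]; exact octagonNode_mono ha o (Nat.zero_le _)), hz0]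
    · rcases (Nat.lt_succ_iff.1 hk).eq_or_lt with h | h
      · obtain rfl : k = ⟨n, hn⟩ := Fin.ext h
        have := (hy t ht).congr (fun s hs => hy2 s hs.1) (hy2 t ht.1)
        rwa [hy2 t ht.1]
      · have hkn : octagonNode a o (k.val + 1) ≤ octagonNode a o n := octagonNode_mono ha o h
        have := (hz k h t ht).congr (fun s hs => hy1 s (hs.2.trans hkn)) (hy1 t (ht.2.trans hkn))
        rwa [hy1 t (ht.2.trans hkn)]

/-! ### The Lie bracket at the straight states. -/

theorem totalForce_eq_midpoint (S : Swimmer) (z : State) (p : Fin 3 → ℝ) (w : Fin 2 → ℝ)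
    (k : Fin 2) : totalForce S z p w k =
      ∑ i, linkLength S i * dragForce S z p w i (linkLength S i / 2) k := by
  rw [totalForce_eq_simpson]
  refine Finset.sum_congr rfl fun i _ => ?_
  rw [simpson, dragForce_affine S z p w i (linkLength S i),
    dragForce_affine S z p w i (linkLength S i / 2)]
  ring

theorem dragForce_zero (S : Swimmer) (z : State) (p : Fin 3 → ℝ) (w : Fin 2 → ℝ) (i : Fin 3)
    (s : ℝ) : dragForce S z p w i s 0 =
      -(S.ξ * (pointVel S z p w i s 0 * Real.cos (linkAngle z i)
        + pointVel S z p w i s 1 * Real.sin (linkAngle z i))) * Real.cos (linkAngle z i)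
      + S.η * (-pointVel S z p w i s 0 * Real.sin (linkAngle z i)
        + pointVel S z p w i s 1 * Real.cos (linkAngle z i)) * Real.sin (linkAngle z i) := by
  simp only [dragForce, dotProduct, Fin.sum_univ_two, ePar, ePerp, Pi.sub_apply, Pi.smul_apply,
    smul_eq_mul, cons_val_zero, cons_val_one]
  ring

/-- Derivative of the x-component of the force on a link as the link passes the x-axis. -/
theorem hasDerivAt_dragForce_zero (S : Swimmer) {γ : ℝ → State} {p : ℝ → Fin 3 → ℝ}
    (w : Fin 2 → ℝ) (i : Fin 3) (s : ℝ) {φ' v' u' : ℝ}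
    (hφ : HasDerivAt (fun t => linkAngle (γ t) i) φ' 0) (hφ0 : linkAngle (γ 0) i = 0)
    (hv : HasDerivAt (fun t => pointVel S (γ t) (p t) w i s 0) v' 0)
    (hv0 : pointVel S (γ 0) (p 0) w i s 0 = 0)
    (hu : HasDerivAt (fun t => pointVel S (γ t) (p t) w i s 1) u' 0) :
    HasDerivAt (fun t => dragForce S (γ t) (p t) w i s 0)
      (-(S.ξ * v') + (S.η - S.ξ) * pointVel S (γ 0) (p 0) w i s 1 * φ') 0 := by
  simp only [dragForce_zero]
  have hc := hφ.cos
  have hs := hφ.sin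
  refine ((((((hv.mul hc).add (hu.mul hs)).const_mul S.ξ).neg).mul hc).add
    ((((hv.neg.mul hs).add (hu.mul hc)).const_mul S.η).mul hs)).congr_deriv ?_
  simp [hφ0, hv0]
  ring

theorem hasDerivAt_pointVel (S : Swimmer) {γ : ℝ → State} {γ' : State} {p : ℝ → Fin 3 → ℝ}
    {p' : Fin 3 → ℝ} (hγ : HasDerivAt γ γ' 0) (hp : HasDerivAt p p' 0)
    (h0 : ∀ i, linkAngle (γ 0) i = 0) (w : Fin 2 → ℝ) (i : Fin 3) (s : ℝ) :
    HasDerivAt (fun t => pointVel S (γ t) (p t) w i s 0)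
      (p' 0 + ![S.L₂ / 2 * p 0 2 * γ' 4 + s * (p 0 2 - w 0) * (γ' 4 - γ' 0),
        (s - S.L₂ / 2) * p 0 2 * γ' 4,
        -(S.L₂ / 2 * p 0 2 * γ' 4) - s * (p 0 2 - w 1) * (γ' 4 - γ' 1)] i) 0 ∧
    HasDerivAt (fun t => pointVel S (γ t) (p t) w i s 1)
      (p' 1 + ![-(S.L₂ / 2) - s, S.L₂ / 2 - s, S.L₂ / 2 + s] i * p' 2) 0 := by
  have hp0 := hasDerivAt_pi.1 hp 0
  have hp1 := hasDerivAt_pi.1 hp 1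
  have hp2 := hasDerivAt_pi.1 hp 2
  have hγ4 := hasDerivAt_pi.1 hγ 4
  have hγ0 := hγ4.sub (hasDerivAt_pi.1 hγ 0)
  have hγ1 := hγ4.sub (hasDerivAt_pi.1 hγ 1)
  have c1 : γ 0 4 = 0 := by simpa [linkAngle] using h0 1
  have c0 : γ 0 0 = 0 := by simpa [linkAngle, c1] using h0 0
  have c2 : γ 0 1 = 0 := by simpa [linkAngle, c1] using h0 2
  fin_cases i
  · simp only [pointVel, ePerp, cons_val_zero, Pi.sub_apply, Pi.smul_apply, smul_eq_mul,
      cons_val_one, Fin.zero_eta]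
    refine ⟨((hp0.sub ((hp2.const_mul (S.L₂ / 2)).mul hγ4.sin.neg)).sub
      (((hp2.sub_const (w 0)).const_mul s).mul hγ0.sin.neg)).congr_deriv ?_,
      ((hp1.sub ((hp2.const_mul (S.L₂ / 2)).mul hγ4.cos)).sub
      (((hp2.sub_const (w 0)).const_mul s).mul hγ0.cos)).congr_deriv ?_⟩
    · simp [c0, c1]; ring
    · simp [c0, c1]; ring
  · simp only [pointVel, ePerp, cons_val_zero, Pi.sub_apply, Pi.smul_apply, smul_eq_mul,
      cons_val_one, Fin.mk_one]
    refine ⟨(hp0.sub ((hp2.const_mul (s - S.L₂ / 2)).mul hγ4.sin.neg)).congr_deriv ?_,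
      (hp1.sub ((hp2.const_mul (s - S.L₂ / 2)).mul hγ4.cos)).congr_deriv ?_⟩
    · simp [c1]
    · simp [c1]; ring
  · simp only [pointVel, ePerp, Pi.add_apply, cons_val_zero, Pi.smul_apply, smul_eq_mul,
      cons_val_one, cons_val, Fin.reduceFinMk]
    refine ⟨((hp0.add ((hp2.const_mul (S.L₂ / 2)).mul hγ4.sin.neg)).add
      (((hp2.sub_const (w 1)).const_mul s).mul hγ1.sin.neg)).congr_deriv ?_,
      ((hp1.add ((hp2.const_mul (S.L₂ / 2)).mul hγ4.cos)).add
      (((hp2.sub_const (w 1)).const_mul s).mul hγ1.cos)).congr_deriv ?_⟩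
    · simp [c1, c2]; ring
    · simp [c1, c2]; ring

theorem bodyVel_straight {S : Swimmer} (hL : 0 < S.L) (hL₂ : 0 < S.L₂) (hξ : 0 < S.ξ)
    (hη : 0 < S.η) (j : Fin 2) (x₀ y₀ : ℝ) : bodyVel S j ![0, 0, x₀, y₀, 0] =
      ![0, ![-1, 1] j * (S.L ^ 2 / (2 * (2 * S.L + S.L₂))),
        S.L ^ 2 * (3 * S.L₂ + 4 * S.L) / (2 * S.L + S.L₂) ^ 3] := by
  refine eq_bodyVel hL hL₂ hξ hη ?_
  have hH : 2 * S.L + S.L₂ ≠ 0 := by positivity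
  ext i
  fin_cases j <;> fin_cases i <;>
    simp [resultant, totalForce_eq_midpoint, totalTorque_eq_simpson, simpson, dragForce, pointVel,
      relPos, ePar, ePerp, linkAngle, linkLength, dotProduct, Fin.sum_univ_succ, vecHead,
      vecTail] <;> field_simp <;> ring

/-- Derivative, at the straight position, of the x-velocity in a control vector field. -/
theorem fderiv_g_two {S : Swimmer} (hL : 0 < S.L) (hL₂ : 0 < S.L₂) (hξ : 0 < S.ξ)
    (hη : 0 < S.η) (j : Fin 2) (x₀ y₀ : ℝ) (v : State) {w : Fin 2 → ℝ} (hw : w = Pi.single j 1)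
    {b c : ℝ} (hb : b = ![-1, 1] j * (S.L ^ 2 / (2 * (2 * S.L + S.L₂))))
    (hc : c = S.L ^ 2 * (3 * S.L₂ + 4 * S.L) / (2 * S.L + S.L₂) ^ 3) :
    (2 * S.L + S.L₂) * S.ξ * fderiv ℝ (g S j) ![0, 0, x₀, y₀, 0] v 2 =
      S.L * (-S.ξ * (S.L₂ / 2 * c * v 4 + S.L / 2 * (c - w 0) * (v 4 - v 0))
        + (S.η - S.ξ) * (b - S.L₂ / 2 * c - S.L / 2 * (c - w 0)) * (v 4 - v 0))
      + S.L₂ * ((S.η - S.ξ) * b * v 4)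
      + S.L * (-S.ξ * (-(S.L₂ / 2 * c * v 4) - S.L / 2 * (c - w 1) * (v 4 - v 1))
        + (S.η - S.ξ) * (b + S.L₂ / 2 * c + S.L / 2 * (c - w 1)) * (v 4 - v 1)) := by
  set z₀ : State := ![0, 0, x₀, y₀, 0] with hz₀
  have hγ : HasDerivAt (fun t : ℝ => z₀ + t • v) v 0 := by
    simpa using ((hasDerivAt_id (0 : ℝ)).smul_const v).const_add z₀
  have hg : HasDerivAt (fun t : ℝ => g S j (z₀ + t • v)) (fderiv ℝ (g S j) z₀ v) 0 := by
    have hF : HasFDerivAt (g S j) (fderiv ℝ (g S j) z₀) (z₀ + (0 : ℝ) • v) := by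
      rw [zero_smul, add_zero]
      exact ((contDiff_g hL hL₂ hξ hη 1 j).differentiable one_ne_zero z₀).hasFDerivAt
    exact hF.comp_hasDerivAt (0 : ℝ) hγ
  set q := fderiv ℝ (g S j) z₀ v
  have hp : HasDerivAt (fun t : ℝ => bodyVel S j (z₀ + t • v)) ![q 2, q 3, q 4] 0 := by
    rw [hasDerivAt_pi]
    have := hasDerivAt_pi.1 hg
    intro i
    fin_cases i
    · exact this 2
    · exact this 3
    · exact this 4
  have hz0 : z₀ + (0 : ℝ) • v = z₀ := by simp
  have hp0 : bodyVel S j (z₀ + (0 : ℝ) • v) = ![0, b, c] := by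
    rw [hz0, hb, hc]; exact bodyVel_straight hL hL₂ hξ hη j x₀ y₀
  have h0 : ∀ i, linkAngle (z₀ + (0 : ℝ) • v) i = 0 := by
    rw [hz0]; intro i; fin_cases i <;> simp [linkAngle, hz₀]
  have hφ : ∀ i, HasDerivAt (fun t : ℝ => linkAngle (z₀ + t • v) i)
      (![v 4 - v 0, v 4, v 4 - v 1] i) 0 := by
    have := hasDerivAt_pi.1 hγ
    intro i
    fin_cases i
    · exact (this 4).sub (this 0)
    · exact this 4
    · exact (this 4).sub (this 1)
  have hd := fun i => hasDerivAt_dragForce_zero S w i (linkLength S i / 2) (hφ i) (h0 i)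
    (hasDerivAt_pointVel S hγ hp h0 w i _).1
    -- In a straight state with `p 0 = 0`, every point moves perpendicularly to the x-axis.
    (by
      rw [hp0, hz0]
      fin_cases i <;> simp [pointVel, ePerp, hz₀, vecHead, vecTail])
    (hasDerivAt_pointVel S hγ hp h0 w i _).2
  have hsum := HasDerivAt.fun_sum (u := Finset.univ) fun i _ => (hd i).const_mul (linkLength S i)
  -- The x-force vanishes along the whole line, so its derivative does too: a single linear equation
  -- for `q 2`, with coefficient `(2 * S.L + S.L₂) * S.ξ`. The derivatives `q 3` and `q 4` do not
  -- enter.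
  have hzero : ∀ t : ℝ, ∑ i, linkLength S i * dragForce S (z₀ + t • v) (bodyVel S j (z₀ + t • v)) w i
      (linkLength S i / 2) 0 = 0 := fun t => by
    rw [← totalForce_eq_midpoint, hw]
    exact congrFun (resultant_bodyVel hL hL₂ hξ hη j (z₀ + t • v)) 0
  simp only [hzero] at hsum
  have h := hsum.unique (hasDerivAt_const (0 : ℝ) (0 : ℝ))
  rw [hp0, hz0] at h
  simp [Fin.sum_univ_three, linkLength, pointVel, ePerp, hz₀, vecHead, vecTail] at h
  linear_combination -h

theorem g_zero (S : Swimmer) (j : Fin 2) (z : State) :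
    g S j z 0 = (1 : Matrix (Fin 2) (Fin 2) ℝ) 0 j := rfl

theorem g_one (S : Swimmer) (j : Fin 2) (z : State) :
    g S j z 1 = (1 : Matrix (Fin 2) (Fin 2) ℝ) 1 j := rfl

theorem bodyVel_zero (S : Swimmer) (j : Fin 2) (z : State) : bodyVel S j z 0 = g S j z 2 := by
  simp [bodyVel]

theorem bodyVel_one (S : Swimmer) (j : Fin 2) (z : State) : bodyVel S j z 1 = g S j z 3 := by
  simp [bodyVel]

theorem bodyVel_two (S : Swimmer) (j : Fin 2) (z : State) : bodyVel S j z 2 = g S j z 4 := by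
  simp [bodyVel]

theorem g_reflect {S : Swimmer} (hL : 0 < S.L) (hL₂ : 0 < S.L₂) (hξ : 0 < S.ξ)
    (hη : 0 < S.η) (j : Fin 2) {z z' : State} (h0 : z' 0 = -z 0) (h1 : z' 1 = -z 1)
    (h4 : z' 4 = -z 4) : g S j z' 2 = -g S j z 2 ∧ ∀ i, i ≠ 2 → g S j z' i = g S j z i := by
  have h := bodyVel_reflect hL hL₂ hξ hη j h0 h1 h4
  have e0 := congrFun h 0
  have e1 := congrFun h 1
  have e2 := congrFun h 2
  simp only [cons_val_zero, cons_val_one, cons_val, bodyVel_zero, bodyVel_one, bodyVel_two]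
    at e0 e1 e2
  refine ⟨e0, fun i hi => ?_⟩
  have k0 : g S j z' 0 = g S j z 0 := by rw [g_zero, g_zero]
  have k1 : g S j z' 1 = g S j z 1 := by rw [g_one, g_one]
  generalize g S j z' = G' at *
  generalize g S j z = G at *
  fin_cases i
  · exact k0
  · exact k1
  · exact absurd rfl hi
  · exact e1
  · exact e2

theorem g_reflect_straight {S : Swimmer} (hL : 0 < S.L) (hL₂ : 0 < S.L₂) (hξ : 0 < S.ξ)
    (hη : 0 < S.η) (j : Fin 2) (x₀ y₀ : ℝ) (w : State) :
    g S j (![0, 0, x₀, y₀, 0] - w) 2 = -g S j (![0, 0, x₀, y₀, 0] + w) 2 ∧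
      ∀ i, i ≠ 2 → g S j (![0, 0, x₀, y₀, 0] - w) i = g S j (![0, 0, x₀, y₀, 0] + w) i :=
  g_reflect hL hL₂ hξ hη j (by simp) (by simp) (by simp)

theorem fderiv_g_apply {S : Swimmer} (hL : 0 < S.L) (hL₂ : 0 < S.L₂) (hξ : 0 < S.ξ)
    (hη : 0 < S.η) (j : Fin 2) (z v : State) (i : Fin 5) :
    fderiv ℝ (g S j) z v i = fderiv ℝ (fun z => g S j z i) z v := by
  have h := ((contDiff_g hL hL₂ hξ hη 1 j).differentiable one_ne_zero z).hasFDerivAt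
  rw [(hasFDerivAt_pi'.1 h i).fderiv]
  rfl

theorem lieBracket_straight {S : Swimmer} (hL : 0 < S.L) (hL₂ : 0 < S.L₂) (hξ : 0 < S.ξ)
    (hη : 0 < S.η) (x₀ y₀ : ℝ) :
    VectorField.lieBracket ℝ (g S 0) (g S 1) ![0, 0, x₀, y₀, 0] =
      ![0, 0, bracketCoeff S, 0, 0] := by
  -- By reflection these components are even about the straight state.
  have heven : ∀ j i v, i ≠ 2 → fderiv ℝ (g S j) ![0, 0, x₀, y₀, 0] v i = 0 := fun j i v hi => by
    rw [fderiv_g_apply hL hL₂ hξ hη, fderiv_eq_zero_of_even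
      fun w => (g_reflect_straight hL hL₂ hξ hη j x₀ y₀ w).2 i hi]
    rfl
  have h2 : VectorField.lieBracket ℝ (g S 0) (g S 1) ![0, 0, x₀, y₀, 0] 2 = bracketCoeff S := by
    have hH : 2 * S.L + S.L₂ ≠ 0 := by positivity
    have e1 := fderiv_g_two hL hL₂ hξ hη 1 x₀ y₀ (g S 0 ![0, 0, x₀, y₀, 0]) rfl rfl rfl
    have e0 := fderiv_g_two hL hL₂ hξ hη 0 x₀ y₀ (g S 1 ![0, 0, x₀, y₀, 0]) rfl rfl rfl
    have a0 : g S 0 ![0, 0, x₀, y₀, 0] 4 = S.L ^ 2 * (3 * S.L₂ + 4 * S.L) / (2 * S.L + S.L₂) ^ 3 :=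
      (bodyVel_two S 0 _).symm.trans (congrFun (bodyVel_straight hL hL₂ hξ hη 0 x₀ y₀) 2)
    have a1 : g S 1 ![0, 0, x₀, y₀, 0] 4 = S.L ^ 2 * (3 * S.L₂ + 4 * S.L) / (2 * S.L + S.L₂) ^ 3 :=
      (bodyVel_two S 1 _).symm.trans (congrFun (bodyVel_straight hL hL₂ hξ hη 1 x₀ y₀) 2)
    rw [a0, g_zero, g_one] at e1
    rw [a1, g_zero, g_one] at e0
    have hne : (2 * S.L + S.L₂) * S.ξ ≠ 0 := by positivity
    rw [VectorField.lieBracket, Pi.sub_apply, ← mul_right_inj' hne, mul_sub, e1, e0, bracketCoeff]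
    simp [one_apply]
    field_simp
    ring
  ext i
  by_cases hi : i = 2
  · subst hi
    simpa using h2
  · rw [VectorField.lieBracket, Pi.sub_apply, heven _ _ _ hi, heven _ _ _ hi]
    fin_cases i <;> simp at hi ⊢

/-! ### Closure and signed area of the octagon. -/

/-- The control on the successive sides of the octagon, extended by zero to all indices. -/
def octagonVelocity (o : Sense) (k : ℕ) : Fin 2 → ℝ :=
  if h : k < 8 then octagonControl o ⟨k, h⟩ else 0

theorem octagonVelocity_of_lt (o : Sense) {k : ℕ} (h : k < 8) :
    octagonVelocity o k = octagonControl o ⟨k, h⟩ := dif_pos h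

theorem abs_octagonVelocity_le (o : Sense) (k : ℕ) (i : Fin 2) : |octagonVelocity o k i| ≤ 1 := by
  unfold octagonVelocity
  split_ifs with h
  · exact abs_octagonControl_le o ⟨k, h⟩ i
  · simp

theorem octagonNode_succ_sub (a : Fin 4 → ℝ) (o : Sense) {k : ℕ} (h : k < 8) :
    octagonNode a o (k + 1) - octagonNode a o k = octagonSide a o ⟨k, h⟩ := by
  rw [octagonNode_succ a o ⟨k, h⟩, add_sub_cancel_left]

theorem polygonVertex_octagon_succ (a : Fin 4 → ℝ) (o : Sense) {k : ℕ} (h : k < 8) (i : Fin 2) :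
    polygonVertex (octagonNode a o) (octagonVelocity o) (k + 1) i =
      polygonVertex (octagonNode a o) (octagonVelocity o) k i
        + octagonSide a o ⟨k, h⟩ * octagonControl o ⟨k, h⟩ i := by
  rw [polygonVertex_succ, octagonNode_succ_sub a o h, octagonVelocity_of_lt o h]

theorem polygonArea_octagon_succ (a : Fin 4 → ℝ) (o : Sense) {k : ℕ} (h : k < 8) (i j : Fin 2) :
    polygonArea (octagonNode a o) (octagonVelocity o) (k + 1) i j =
      polygonArea (octagonNode a o) (octagonVelocity o) k i j + octagonControl o ⟨k, h⟩ j *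
        (polygonVertex (octagonNode a o) (octagonVelocity o) k i * octagonSide a o ⟨k, h⟩
          + octagonControl o ⟨k, h⟩ i * (octagonSide a o ⟨k, h⟩ ^ 2 / 2)) := by
  rw [polygonArea_succ, octagonNode_succ_sub a o h, octagonVelocity_of_lt o h]

theorem polygonVertex_zero (T : ℕ → ℝ) (u : ℕ → Fin 2 → ℝ) (i : Fin 2) :
    polygonVertex T u 0 i = 0 := rfl

theorem polygonArea_zero (T : ℕ → ℝ) (u : ℕ → Fin 2 → ℝ) (i j : Fin 2) :
    polygonArea T u 0 i j = 0 := rfl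

/-- The octagon is closed. -/
theorem polygonVertex_octagon (a : Fin 4 → ℝ) (o : Sense) (i : Fin 2) :
    polygonVertex (octagonNode a o) (octagonVelocity o) 8 i = 0 := by
  have h := fun k (hk : k < 8) => polygonVertex_octagon_succ a o hk i
  rw [h 7 (by norm_num), h 6 (by norm_num), h 5 (by norm_num), h 4 (by norm_num),
    h 3 (by norm_num), h 2 (by norm_num), h 1 (by norm_num), h 0 (by norm_num), polygonVertex_zero]
  cases o <;> fin_cases i <;> simp [octagonSide, octagonControl] <;> ring

/-- The area enclosed by the octagon. -/
theorem polygonArea_octagon (a : Fin 4 → ℝ) (o : Sense) (i j : Fin 2) :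
    polygonArea (octagonNode a o) (octagonVelocity o) 8 i j =
      o.sign * strokeC a * !![0, 1; -1, 0] i j := by
  have h := fun k (hk : k < 8) => polygonArea_octagon_succ a o hk i j
  have h' := fun k (hk : k < 8) => polygonVertex_octagon_succ a o hk i
  have h2 : √2 ^ 2 = (2 : ℝ) := Real.sq_sqrt (by norm_num)
  rw [h 7 (by norm_num), h 6 (by norm_num), h 5 (by norm_num), h 4 (by norm_num),
    h 3 (by norm_num), h 2 (by norm_num), h 1 (by norm_num), h 0 (by norm_num),
    h' 6 (by norm_num), h' 5 (by norm_num), h' 4 (by norm_num),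
    h' 3 (by norm_num), h' 2 (by norm_num), h' 1 (by norm_num), h' 0 (by norm_num),
    polygonVertex_zero, polygonArea_zero]
  cases o <;> fin_cases i <;> fin_cases j <;>
    simp [octagonSide, octagonControl, strokeC, Sense.sign] <;> ring_nf <;>
    (try simp only [h2]) <;> (try ring)

theorem IsStrokeMotion.polygon {S : Swimmer} {a : Fin 4 → ℝ} {o : Sense} {z₀ : State}
    {z : ℝ → State} (h : IsStrokeMotion S a o z₀ z) :
    ∀ k < 8, ∀ t ∈ Icc (octagonNode a o k) (octagonNode a o (k + 1)),
      HasDerivWithinAt z (∑ i, octagonVelocity o k i • g S i (z t))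
        (Icc (octagonNode a o k) (octagonNode a o (k + 1))) t := fun k hk t ht => by
  rw [octagonVelocity_of_lt o hk, Fin.sum_univ_two]
  exact h.ode ⟨k, hk⟩ t ht

/-! ### Displacement in small strokes. -/

theorem perimeter_le {a : Fin 4 → ℝ} : perimeter a ≤ 8 * ‖a‖ := by
  have h : ∀ i, a i ≤ ‖a‖ := fun i => (le_abs_self _).trans (norm_le_pi_norm a i)
  have h0 := h 0
  have h1 := h 1
  have h2 := h 2
  have h3 := h 3
  unfold perimeter
  linarith

theorem exists_uniform_bound {ι E : Type*} [Fintype ι] [SeminormedAddCommGroup E] {x₀ : E}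
    {f : ι → E → ℝ} {m : ℕ}
    (h : ∀ j, ∃ K > 0, ∃ r > 0, ∀ x, ‖x - x₀‖ < r → f j x ≤ K * ‖x - x₀‖ ^ m) :
    ∃ K > 0, ∃ r > 0, ∀ j x, ‖x - x₀‖ < r → f j x ≤ K * ‖x - x₀‖ ^ m := by
  choose K hK r hr h using h
  have hr' : ∃ ρ > 0, ∀ j, ρ ≤ r j := by
    rcases isEmpty_or_nonempty ι with _ | _
    · exact ⟨1, one_pos, fun j => isEmptyElim j⟩
    · obtain ⟨i, hi⟩ := Finite.exists_min r
      exact ⟨r i, hr i, hi⟩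
  obtain ⟨ρ, hρ, hle⟩ := hr'
  refine ⟨1 + ∑ j, K j, by have := Finset.sum_nonneg fun j (_ : j ∈ Finset.univ) => (hK j).le
                           linarith, ρ, hρ, fun j x hx => ?_⟩
  refine (h j x (hx.trans_le (hle j))).trans ?_
  gcongr
  have := Finset.single_le_sum (fun j _ => (hK j).le) (Finset.mem_univ j)
  linarith

/-- Second order expansion of the displacement in small octagonal strokes, seen through `φ`. The
order of the remainder depends on the order at which the control vector fields, seen through `π`,
are constant. -/
theorem stroke_expansion {S : Swimmer} (hL : 0 < S.L) (hL₂ : 0 < S.L₂) (hξ : 0 < S.ξ)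
    (hη : 0 < S.η) {F : Type*} [NormedAddCommGroup F] [NormedSpace ℝ F] (o : Sense) (z₀ : State)
    (π : State →L[ℝ] State) (φ : State →L[ℝ] F) (D : Fin 2 → State →L[ℝ] F) {m : ℕ}
    (h1 : ∀ j, ∃ K > 0, ∃ r > 0, ∀ x, ‖x - z₀‖ < r →
      ‖π (g S j x - g S j z₀)‖ ≤ K * ‖x - z₀‖ ^ m)
    (h2 : ∀ j, ∃ K > 0, ∃ r > 0, ∀ x, ‖x - z₀‖ < r →
      ‖φ (g S j x - g S j z₀) - D j (π (x - z₀))‖ ≤ K * ‖x - z₀‖ ^ (m + 1)) :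
    ∃ K > 0, ∃ δ > 0, ∀ a : Fin 4 → ℝ, (∀ i, 0 ≤ a i) → ‖a‖ < δ →
      ∀ z : ℝ → State, IsStrokeMotion S a o z₀ z →
        ‖φ (z (perimeter a) - z 0) - (o.sign * strokeC a) •
          (D 1 (π (g S 0 z₀)) - D 0 (π (g S 1 z₀)))‖ ≤ K * ‖a‖ ^ (m + 2) := by
  obtain ⟨M, hM0, hM⟩ := exists_norm_g_le hL hL₂ hξ hη
  obtain ⟨K₁, hK₁, r₁, hr₁, h1⟩ := exists_uniform_bound h1
  obtain ⟨K₂, hK₂, r₂, hr₂, h2⟩ := exists_uniform_bound h2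
  set B := ‖D 0‖ + ‖D 1‖ with hB
  have hB0 : 0 ≤ B := by positivity
  have hDB : ∀ j, ‖D j‖ ≤ B := fun j => by
    fin_cases j <;> simp [hB]
  -- The perimeter is at most `8 * ‖a‖` and the speed at most `2 * M`, so the motion stays within
  -- `16 * M * ‖a‖` of `z₀`; `δ` keeps this below both radii.
  refine ⟨2 * (K₂ * (16 * M) ^ (m + 1) + B * (2 * (K₁ * (16 * M) ^ m) * 8)) * 8, by positivity,
    min r₁ r₂ / (16 * M), by positivity, fun a ha had z hz => ?_⟩
  rw [lt_div_iff₀ (by positivity)] at had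
  have hT : ∀ k < 8, octagonNode a o k ≤ octagonNode a o (k + 1) :=
    fun k hk => octagonNode_le_succ ha o ⟨k, hk⟩
  have hT8 := octagonNode_eight a o
  have hP := perimeter_le (a := a)
  have hdist : ∀ k < 8, ∀ t ∈ Icc (octagonNode a o k) (octagonNode a o (k + 1)),
      ‖z t - z₀‖ ≤ 16 * M * ‖a‖ := fun k hk t ht => by
    have h := norm_sub_le_of_polygon hT (octagonNode_zero a o) (abs_octagonVelocity_le o)
      hz.polygon hM k hk t ht
    rw [hz.init] at h
    have ht8 : t ≤ 8 * ‖a‖ :=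
      (ht.2.trans (octagonNode_mono ha o (by omega : k + 1 ≤ 8))).trans (hT8.le.trans hP)
    calc ‖z t - z₀‖ ≤ 2 * M * t := h
      _ ≤ 2 * M * (8 * ‖a‖) := by gcongr
      _ = 16 * M * ‖a‖ := by ring
  have hmain := norm_second_order_le_of_polygon (G := g S) (C := K₁ * (16 * M * ‖a‖) ^ m)
    (C' := K₂ * (16 * M * ‖a‖) ^ (m + 1)) hT (octagonNode_zero a o)
    (abs_octagonVelocity_le o) hz.polygon π φ D (by positivity) hDB
    (fun k hk t ht j => by
      have hd := hdist k hk t ht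
      rw [hz.init]
      refine (h1 j (z t) (hd.trans_lt ?_)).trans (by gcongr)
      linarith [min_le_left r₁ r₂])
    (fun k hk t ht j => by
      have hd := hdist k hk t ht
      rw [hz.init]
      refine (h2 j (z t) (hd.trans_lt ?_)).trans (by gcongr)
      linarith [min_le_right r₁ r₂])
    (by norm_num)
  have hP0 : 0 ≤ perimeter a := by
    have h := octagonNode_mono ha o (Nat.zero_le 8)
    rwa [octagonNode_zero, hT8] at h
  simp only [polygonVertex_octagon, polygonArea_octagon, hT8, hz.init, Fin.sum_univ_two, zero_smul,
    add_zero, sub_zero] at hmain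
  simp only [of_apply, cons_val_zero, cons_val_one, mul_zero, zero_smul, mul_one, zero_add, add_zero,
    cons_val_fin_one, mul_neg, neg_smul] at hmain
  rw [hz.init, smul_sub, show ∀ x y w : F, x - (y - w) = x - (-w + y) from fun x y w => by abel]
  refine hmain.trans ?_
  calc _ ≤ 2 * (K₂ * (16 * M * ‖a‖) ^ (m + 1)
        + B * (2 * (K₁ * (16 * M * ‖a‖) ^ m) * (8 * ‖a‖))) * (8 * ‖a‖) := by gcongr
    _ = _ := by ring

/-- No projection is needed here: Lipschitz fields with quadratic Taylor remainders correspond to `m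
= 1`. -/
theorem displacement_expansion {S : Swimmer} (hL : 0 < S.L) (hL₂ : 0 < S.L₂) (hξ : 0 < S.ξ)
    (hη : 0 < S.η) (o : Sense) (z₀ : State) : ∃ K > 0, ∃ δ > 0,
      ∀ a : Fin 4 → ℝ, (∀ i, 0 ≤ a i) → ‖a‖ < δ →
      ∀ z : ℝ → State, IsStrokeMotion S a o z₀ z →
        ‖z (perimeter a) - z 0 - (o.sign * strokeC a) •
          VectorField.lieBracket ℝ (g S 0) (g S 1) z₀‖ ≤ K * ‖a‖ ^ 3 :=
  stroke_expansion hL hL₂ hξ hη o z₀ (.id ℝ State) (.id ℝ State) (fun j => fderiv ℝ (g S j) z₀)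
    (m := 1)
    (fun j => by simpa using exists_norm_sub_le (contDiff_g hL hL₂ hξ hη 1 j) z₀)
    (fun j => exists_norm_sub_fderiv_le (contDiff_g hL hL₂ hξ hη 2 j) z₀)

/-- The projection that forgets the x-coordinate of the swimmer. -/
def forgetX : State →L[ℝ] State :=
  ContinuousLinearMap.pi fun i => if i = 2 then 0 else ContinuousLinearMap.proj i

theorem forgetX_apply (z : State) (i : Fin 5) : forgetX z i = if i = 2 then 0 else z i := by
  by_cases h : i = 2 <;> simp [forgetX, h]

theorem norm_forgetX_le (z : State) : ‖forgetX z‖ ≤ ‖z‖ := by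
  refine (pi_norm_le_iff_of_nonneg (norm_nonneg _)).2 fun i => ?_
  rw [forgetX_apply]
  split_ifs
  · simp
  · exact norm_le_pi_norm z i

theorem g_forgetX (S : Swimmer) (j : Fin 2) (z₀ x : State) :
    g S j (z₀ + forgetX (x - z₀)) = g S j x :=
  g_congr S (fun i => by congr 1; fin_cases i <;> simp [linkAngle, forgetX_apply]) j

/-- Here `φ` reads the odd x-component and `π` drops it, keeping the even ones. Dropping it loses
nothing, because the fields do not depend on `x`, and it allows `m = 2`. -/
theorem x_displacement_expansion {S : Swimmer} (hL : 0 < S.L) (hL₂ : 0 < S.L₂) (hξ : 0 < S.ξ)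
    (hη : 0 < S.η) (o : Sense) (x₀ y₀ : ℝ) : ∃ K > 0, ∃ δ > 0,
      ∀ a : Fin 4 → ℝ, (∀ i, 0 ≤ a i) → ‖a‖ < δ →
      ∀ z : ℝ → State, IsStrokeMotion S a o ![0, 0, x₀, y₀, 0] z →
        |z (perimeter a) 2 - z 0 2 - o.sign * strokeC a * bracketCoeff S| ≤ K * ‖a‖ ^ 4 := by
  have hrefl := fun j w => g_reflect_straight hL hL₂ hξ hη j x₀ y₀ w
  have hstraight : ∀ j, forgetX (g S j ![0, 0, x₀, y₀, 0]) = g S j ![0, 0, x₀, y₀, 0] := fun j => by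
    ext i
    rw [forgetX_apply]
    split_ifs with hi
    · have h := congrFun (bodyVel_straight hL hL₂ hξ hη j x₀ y₀) 0
      rw [bodyVel_zero] at h
      rw [hi, h]
      rfl
    · rfl
  have hbr := congrFun (lieBracket_straight hL hL₂ hξ hη x₀ y₀) 2
  rw [VectorField.lieBracket, Pi.sub_apply, fderiv_g_apply hL hL₂ hξ hη,
    fderiv_g_apply hL hL₂ hξ hη] at hbr
  replace hbr : _ = bracketCoeff S := hbr
  have hcomp : ∀ j n, ContDiff ℝ n fun z => g S j z 2 := fun j n =>
    contDiff_pi.1 (contDiff_g hL hL₂ hξ hη n j) 2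
  generalize (![0, 0, x₀, y₀, 0] : State) = z₀ at *
  have key := stroke_expansion hL hL₂ hξ hη o z₀ forgetX (ContinuousLinearMap.proj 2)
    (fun j => fderiv ℝ (fun z => g S j z 2) z₀) (m := 2)
    (fun j => by
      have h := exists_norm_sub_le_of_even (x₀ := z₀)
        (forgetX.contDiff.comp (contDiff_g hL hL₂ hξ hη 2 j)) fun w => by
          ext i
          simp only [Function.comp_apply, forgetX_apply]
          split_ifs with hi
          · rfl
          · exact (hrefl j w).2 i hi
      simpa using h)
    (fun j => by
      obtain ⟨K, hK, r, hr, h⟩ := exists_norm_sub_fderiv_le_of_odd (hcomp j 3)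
        fun w => (hrefl j w).1
      refine ⟨K, hK, r, hr, fun x hx => ?_⟩
      -- The point is translated along the x-axis, which leaves the field unchanged and turns its
      -- displacement from `z₀` into `forgetX (x - z₀)`.
      have h' := h (z₀ + forgetX (x - z₀))
        (by rw [add_sub_cancel_left]; exact (norm_forgetX_le _).trans_lt hx)
      rw [add_sub_cancel_left, g_forgetX] at h'
      refine h'.trans ?_
      gcongr
      exact norm_forgetX_le _)
  obtain ⟨K, hK, δ, hδ, h⟩ := key
  refine ⟨K, hK, δ, hδ, fun a ha had z hz => ?_⟩
  have := h a ha had z hz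
  rwa [hstraight, hstraight, hbr] at this

end Purcell

end

theorem mainTheorem1 (S : Purcell.Swimmer)
    (hL : 0 < S.L) (hL₂ : 0 < S.L₂) (hξ : 0 < S.ξ) (hη : 0 < S.η) :
    -- the grand resistance matrix is invertible at every state
    (∀ z : Purcell.State, IsUnit (Purcell.matA S z).det) ∧
    -- every octagonal stroke drives a motion from every initial state
    (∀ (o : Purcell.Sense) (z₀ : Purcell.State) (a : Fin 4 → ℝ), (∀ i, 0 ≤ a i) →
      ∃ z : ℝ → Purcell.State, Purcell.IsStrokeMotion S a o z₀ z) ∧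
    -- the displacement of the whole state, at leading order
    (∀ (o : Purcell.Sense) (z₀ : Purcell.State), ∃ K > 0, ∃ δ > 0,
      ∀ a : Fin 4 → ℝ, (∀ i, 0 ≤ a i) → ‖a‖ < δ →
      ∀ z : ℝ → Purcell.State, Purcell.IsStrokeMotion S a o z₀ z →
        ‖z (Purcell.perimeter a) - z 0 - (o.sign * Purcell.strokeC a) •
          VectorField.lieBracket ℝ (Purcell.g S 0) (Purcell.g S 1) z₀‖ ≤ K * ‖a‖ ^ 3) ∧
    -- the Lie bracket at the states with `θ = β₁ = β₃ = 0`
    (∀ x₀ y₀ : ℝ, VectorField.lieBracket ℝ (Purcell.g S 0) (Purcell.g S 1) ![0, 0, x₀, y₀, 0] =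
      ![0, 0, Purcell.bracketCoeff S, 0, 0]) ∧
    -- the x-displacement for strokes that start from `θ = β₁ = β₃ = 0`
    (∀ (o : Purcell.Sense) (x₀ y₀ : ℝ), ∀ ε > 0, ∃ δ > 0,
      ∀ a : Fin 4 → ℝ, (∀ i, 0 ≤ a i) → ‖a‖ < δ →
      ∀ z : ℝ → Purcell.State, Purcell.IsStrokeMotion S a o ![0, 0, x₀, y₀, 0] z →
        |z (Purcell.perimeter a) 2 - z 0 2 - o.sign * Purcell.strokeC a * Purcell.bracketCoeff S|
          ≤ ε * ‖a‖ ^ 3) := by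
  refine ⟨Purcell.isUnit_det_matA hL hL₂ hξ hη,
    fun o z₀ a ha => Purcell.exists_isStrokeMotion hL hL₂ hξ hη o z₀ ha,
    Purcell.displacement_expansion hL hL₂ hξ hη, Purcell.lieBracket_straight hL hL₂ hξ hη,
    fun o x₀ y₀ ε hε => ?_⟩
  obtain ⟨K, hK, δ, hδ, h⟩ := Purcell.x_displacement_expansion hL hL₂ hξ hη o x₀ y₀
  -- The bound `K * ‖a‖ ^ 4` has one power to spare: `‖a‖ < ε / K` turns it into `ε * ‖a‖ ^ 3`.
  refine ⟨min δ (ε / K), by positivity, fun a ha had z hz => ?_⟩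
  refine (h a ha (had.trans_le (min_le_left _ _)) z hz).trans ?_
  have hKa : K * ‖a‖ ≤ ε := by
    have h1 := (had.trans_le (min_le_right _ _)).le
    rwa [le_div_iff₀ hK, mul_comm] at h1
  calc K * ‖a‖ ^ 4 = K * ‖a‖ * ‖a‖ ^ 3 := by ring
    _ ≤ ε * ‖a‖ ^ 3 := by gcongr
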